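/- A graph $E=(E^0,E^1,r,s)$ consists of countable sets $E^0$ (vertices), $E^1$ (edges) and maps $r,s:E^1\to E^0$. A path is a vertex (length $0$) or a sequence $e_1\cdots e_n$ of edges ($n\ge 1$) with $r(e_i)=s(e_{i+1})$ for $1\le i<n$; it ends at $r(e_n)$ (a vertex $v$, as a path, ends at $v$). A cycle is a path $e_1\cdots e_n$, $n\ge1$, with $r(e_n)=s(e_1)$ and $s(e_i)\ne s(e_j)$ for $i\neq j$. A sink is a vertex $v$ with $s^{-1}(v)=\emptyset$; a graph is finite if $E^0$ and $E^1$ are finite. The Leavitt path algebra $L_{\mathbb C}(E)$ is the free (not necessarily unital) associative $\mathbb C$-algebra on pairwise orthogonal idempotents $v$ ($v\in E^0$) and elements $e,e^*$ ($e\in E^1$), modulo the relations $s(e)e=e\,r(e)=e$, $r(e)e^*=e^*s(e)=e^*$, $e^*f=\delta_{e,f}\,r(e)$, and $v=\sum_{s(e)=v}ee^*$ whenever $0<|s^{-1}(v)|<\infty$; it is a $*$-algebra for the conjugate linear involution with $v\mapsto v$ and $e\mapsto e^*$. The graph $C^*$-algebra $C^*(E)$ is the universal (not necessarily unital) $C^*$-algebra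 generated by mutually orthogonal projections $p_v$ ($v\in E^0$) and partial isometries $s_e$ ($e\in E^1$) with mutually orthogonal ranges (that is, $s_e^*s_f=0$ for $e\ne f$) such that $s_e^*s_e=p_{r(e)}$ and $s_es_e^*\le p_{s(e)}$ for all $e$, and $p_v=\sum_{s(e)=v}s_es_e^*$ whenever $0<|s^{-1}(v)|<\infty$. Let $\iota_E:L_{\mathbb C}(E)\to C^*(E)$ be the $*$-homomorphism with $\iota_E(v)=p_v$ and $\iota_E(e)=s_e$. Proposition. For every graph $E$ the following are equivalent: (1) $\iota_E:L_{\mathbb C}(E)\to C^*(E)$ is surjective; (2) $L_{\mathbb C}(E)\cong C^*(E)$ as $*$-algebras over $\mathbb C$; (3) $L_{\mathbb C}(E)\cong C^*(E)$ as $*$-rings; (4) $E$ is a finite graph with no cycles; (5) $L_{\mathbb C}(E)$ is finite dimensional over $\mathbb C$; (6) $C^*(E)$ is finite dimensional over $\mathbb C$. Moreover, when these hold, for every vertex $v$ the number $n(v)$ of paths that end at $v$ (including the path $v$ of length $0$) is finite, and $L_{\mathbb C}(E)$ and $C^*(E)$ are both isomorphic, as $*$-algebras, to $M_{n(v_1)}(\mathbb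 C)\oplus\cdots\oplus M_{n(v_k)}(\mathbb C)$, where $v_1,\dots,v_k$ are the sinks of $E$. -/

import Mathlib

universe u v

set_option linter.checkUnivs false

/-- A graph `(E⁰, E¹, r, s)`: countable sets of vertices and edges with range and source maps. -/
structure DirGraph where
  Vert : Type u
  Edge : Type v
  r : Edge → Vert
  s : Edge → Vert
  countable_vert : Countable Vert
  countable_edge : Countable Edge

namespace DirGraph

noncomputable section

/-! ### Vertices, paths and cycles -/

variable (E : DirGraph.{u, v})

/-- The set `s⁻¹(v)` of edges emitted by `v`. -/
def emits (v : E.Vert) : Set E.Edge := {e | E.s e = v}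

/-- A sink emits no edge. -/
def IsSink (v : E.Vert) : Prop := E.emits v = ∅

/-- A graph is finite if it has finitely many vertices and finitely many edges. -/
def IsFinite : Prop := Finite E.Vert ∧ Finite E.Edge

/-- `e₁ e₂ … eₙ` is a path: `r(eᵢ) = s(eᵢ₊₁)`. The empty list stands for a path of length zero,
whose vertex is then known from the context. -/
def IsPath (l : List E.Edge) : Prop := l.IsChain (fun e f => E.r e = E.s f)

/-- The paths that end at `v`; the empty list is the path `v` of length zero. -/
def PathTo (v : E.Vert) : Type v :=
  {l : List E.Edge // E.IsPath l ∧ ∀ e ∈ l.getLast?, E.r e = v}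

/-- The number `n(v)` of paths that end at `v` (used only where it is finite). -/
def numPathsTo (v : E.Vert) : ℕ := Nat.card (E.PathTo v)

/-- A cycle is a path `e₁ … eₙ`, `n ≥ 1`, with `r(eₙ) = s(e₁)` and pairwise distinct sources. -/
def IsCycle (l : List E.Edge) : Prop :=
  E.IsPath l ∧ (∃ h : l ≠ [], E.r (l.getLast h) = E.s (l.head h)) ∧ (l.map E.s).Nodup

/-- The graph has no cycles. -/
def NoCycles : Prop := ∀ l : List E.Edge, ¬ E.IsCycle l

/-! ### The free (non-unital) algebra on the vertices, the edges and the ghost edges -/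

/-- The generators `v`, `e`, `e*`. -/
inductive Gen : Type (max u v)
  | vert (v : E.Vert) : Gen
  | edge (e : E.Edge) : Gen
  | ghost (e : E.Edge) : Gen

variable {E} in
/-- The involution of the generators: `v* = v` and `(e)* = e*`. -/
def Gen.adj : E.Gen → E.Gen
  | .vert v => .vert v
  | .edge e => .ghost e
  | .ghost e => .edge e

/-- The free associative (non-unital) complex algebra on the symbols `v`, `e`, `e*`: the semigroup
algebra of the nonempty words. -/
abbrev FreeAlg : Type (max u v) := MonoidAlgebra ℂ (FreeSemigroup E.Gen)

/-- Word reversal together with the involution of the letters. -/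
def wordAdj : FreeSemigroup E.Gen →ₙ* (FreeSemigroup E.Gen)ᵐᵒᵖ :=
  FreeSemigroup.lift fun g => MulOpposite.op (FreeSemigroup.of g.adj)

theorem wordAdj_wordAdj (w : FreeSemigroup E.Gen) :
    (E.wordAdj (E.wordAdj w).unop).unop = w := by
  induction w with
  | ih1 g => cases g <;> rfl
  | ih2 g w h1 h2 => rw [map_mul, MulOpposite.unop_mul, map_mul, MulOpposite.unop_mul, h1, h2]

/-- The conjugate linear involution `(∑ λ w)* = ∑ conj(λ) w*` of the free algebra. -/
def freeStar : E.FreeAlg →+ E.FreeAlg where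
  toFun x := (x.map (starRingEnd ℂ : ℂ →+ ℂ)).mapDomain fun w => (E.wordAdj w).unop
  map_zero' := by simp
  map_add' := by intro x y; simp [MonoidAlgebra.map_add, MonoidAlgebra.mapDomain_add]

theorem freeStar_single (w : FreeSemigroup E.Gen) (c : ℂ) :
    E.freeStar (.single w c) = .single (E.wordAdj w).unop (starRingEnd ℂ c) := by
  simp [freeStar]

instance : StarRing E.FreeAlg where
  star := E.freeStar
  star_involutive x := by
    induction x using MonoidAlgebra.induction_linear with
    | zero => simp
    | add x y hx hy => rw [map_add, map_add, hx, hy]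
    | single w c => rw [freeStar_single, freeStar_single, wordAdj_wordAdj, Complex.conj_conj]
  star_mul x y := by
    change E.freeStar (x * y) = E.freeStar y * E.freeStar x
    induction x using MonoidAlgebra.induction_linear with
    | zero => simp
    | add x x' hx hx' => rw [add_mul, map_add, map_add, hx, hx', mul_add]
    | single w c =>
      induction y using MonoidAlgebra.induction_linear with
      | zero => simp
      | add y y' hy hy' => rw [mul_add, map_add, map_add, hy, hy', add_mul]
      | single w' c' =>
        rw [MonoidAlgebra.single_mul_single]
        simp only [freeStar_single, MonoidAlgebra.single_mul_single, map_mul, MulOpposite.unop_mul,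
          mul_comm]
  star_add x y := map_add E.freeStar x y

theorem star_single (w : FreeSemigroup E.Gen) (c : ℂ) :
    star (MonoidAlgebra.single w c : E.FreeAlg)
      = .single (E.wordAdj w).unop (starRingEnd ℂ c) := E.freeStar_single w c

instance : StarModule ℂ E.FreeAlg where
  star_smul c x := by
    induction x using MonoidAlgebra.induction_linear with
    | zero => simp
    | add x y hx hy => rw [smul_add, star_add, star_add, hx, hy, smul_add]
    | single w d => simp [star_single, MonoidAlgebra.smul_single]

/-- A generator, as an element of the free algebra. -/
def gen (g : E.Gen) : E.FreeAlg := .single (FreeSemigroup.of g) 1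

/-- The symbol `v` in the free algebra. -/
def vt (v : E.Vert) : E.FreeAlg := E.gen (.vert v)

/-- The symbol `e` in the free algebra. -/
def ed (e : E.Edge) : E.FreeAlg := E.gen (.edge e)

/-- The symbol `e*` in the free algebra. -/
def gh (e : E.Edge) : E.FreeAlg := E.gen (.ghost e)

theorem star_gen (g : E.Gen) : star (E.gen g) = E.gen g.adj := by
  rw [gen, star_single]; simp [gen, wordAdj]

@[simp] theorem star_vt (v : E.Vert) : star (E.vt v) = E.vt v := E.star_gen _
@[simp] theorem star_ed (e : E.Edge) : star (E.ed e) = E.gh e := E.star_gen _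
@[simp] theorem star_gh (e : E.Edge) : star (E.gh e) = E.ed e := E.star_gen _

/-! ### The Leavitt path algebra -/

/-- The defining relations of the Leavitt path algebra. -/
inductive LeavittRel : E.FreeAlg → E.FreeAlg → Prop
  | vert_mul_self (v : E.Vert) : LeavittRel (E.vt v * E.vt v) (E.vt v)
  | vert_mul_ne (v w : E.Vert) (h : v ≠ w) : LeavittRel (E.vt v * E.vt w) 0
  | source_mul_edge (e : E.Edge) : LeavittRel (E.vt (E.s e) * E.ed e) (E.ed e)
  | edge_mul_range (e : E.Edge) : LeavittRel (E.ed e * E.vt (E.r e)) (E.ed e)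
  | range_mul_ghost (e : E.Edge) : LeavittRel (E.vt (E.r e) * E.gh e) (E.gh e)
  | ghost_mul_source (e : E.Edge) : LeavittRel (E.gh e * E.vt (E.s e)) (E.gh e)
  | ghost_mul_edge_self (e : E.Edge) : LeavittRel (E.gh e * E.ed e) (E.vt (E.r e))
  | ghost_mul_edge_ne (e f : E.Edge) (h : e ≠ f) : LeavittRel (E.gh e * E.ed f) 0
  | vert_eq_sum (v : E.Vert) (hne : (E.emits v).Nonempty) (hfin : (E.emits v).Finite) :
      LeavittRel (E.vt v) (∑ e ∈ hfin.toFinset, E.ed e * E.gh e)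

theorem LeavittRel.star {a b : E.FreeAlg} (h : E.LeavittRel a b) :
    E.LeavittRel (star a) (star b) := by
  cases h with
  | vert_mul_self v => simpa using LeavittRel.vert_mul_self v
  | vert_mul_ne v w h => simpa using LeavittRel.vert_mul_ne w v h.symm
  | source_mul_edge e => simpa using LeavittRel.ghost_mul_source e
  | edge_mul_range e => simpa using LeavittRel.range_mul_ghost e
  | range_mul_ghost e => simpa using LeavittRel.edge_mul_range e
  | ghost_mul_source e => simpa using LeavittRel.source_mul_edge e
  | ghost_mul_edge_self e => simpa using LeavittRel.ghost_mul_edge_self e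
  | ghost_mul_edge_ne e f h => simpa using LeavittRel.ghost_mul_edge_ne f e h.symm
  | vert_eq_sum v hne hfin => simpa using LeavittRel.vert_eq_sum v hne hfin

variable {E} in
/-- `J` is a two-sided ideal of the free algebra that contains the Leavitt relators. -/
structure IsLeavittIdeal (J : Submodule ℂ E.FreeAlg) : Prop where
  rel : ∀ a b, E.LeavittRel a b → a - b ∈ J
  mul_left : ∀ a x, x ∈ J → a * x ∈ J
  mul_right : ∀ a x, x ∈ J → x * a ∈ J

/-- The two-sided ideal generated by the Leavitt relators. -/
def leavittIdeal : Submodule ℂ E.FreeAlg := sInf {J | IsLeavittIdeal J}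

theorem isLeavittIdeal_leavittIdeal : IsLeavittIdeal E.leavittIdeal where
  rel a b h := Submodule.mem_sInf.2 fun _ hJ => hJ.rel a b h
  mul_left a _ hx := Submodule.mem_sInf.2 fun J hJ =>
    hJ.mul_left a _ (Submodule.mem_sInf.1 hx J hJ)
  mul_right a _ hx := Submodule.mem_sInf.2 fun J hJ =>
    hJ.mul_right a _ (Submodule.mem_sInf.1 hx J hJ)

variable {E} in
theorem leavittIdeal_le {J : Submodule ℂ E.FreeAlg} (hJ : IsLeavittIdeal J) :
    E.leavittIdeal ≤ J := sInf_le hJ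

theorem star_mem_leavittIdeal {x : E.FreeAlg} (hx : x ∈ E.leavittIdeal) :
    star x ∈ E.leavittIdeal := by
  let J : Submodule ℂ E.FreeAlg :=
    { carrier := {y | star y ∈ E.leavittIdeal}
      zero_mem' := by simp
      add_mem' := fun {a b} ha hb => by
        change star (a + b) ∈ E.leavittIdeal
        rw [star_add]; exact add_mem ha hb
      smul_mem' := fun c y hy => by
        change star (c • y) ∈ E.leavittIdeal
        rw [star_smul]; exact E.leavittIdeal.smul_mem (star c) hy }
  have I := E.isLeavittIdeal_leavittIdeal
  have hJ : IsLeavittIdeal J :=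
    { rel := fun a b h => by
        change star (a - b) ∈ E.leavittIdeal
        rw [star_sub]; exact I.rel _ _ h.star
      mul_left := fun a y hy => by
        change star (a * y) ∈ E.leavittIdeal
        rw [star_mul]; exact I.mul_right _ _ hy
      mul_right := fun a y hy => by
        change star (y * a) ∈ E.leavittIdeal
        rw [star_mul]; exact I.mul_left _ _ hy }
  exact leavittIdeal_le hJ hx

/-- The Leavitt path algebra `L_ℂ(E)`. -/
def Leavitt : Type (max u v) := E.FreeAlg ⧸ E.leavittIdeal

namespace Leavitt

instance : AddCommGroup E.Leavitt := inferInstanceAs (AddCommGroup (E.FreeAlg ⧸ E.leavittIdeal))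
instance : Module ℂ E.Leavitt := inferInstanceAs (Module ℂ (E.FreeAlg ⧸ E.leavittIdeal))

/-- The quotient map. -/
def mk : E.FreeAlg →ₗ[ℂ] E.Leavitt := E.leavittIdeal.mkQ

theorem mk_surjective : Function.Surjective (mk E) := E.leavittIdeal.mkQ_surjective

variable {E} in
theorem mk_eq_mk {x y : E.FreeAlg} : mk E x = mk E y ↔ x - y ∈ E.leavittIdeal :=
  Submodule.Quotient.eq _

instance : Mul E.Leavitt where
  mul := Quotient.map₂ (· * ·) fun a a' ha b b' hb => by
    have I := E.isLeavittIdeal_leavittIdeal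
    have ha := (Submodule.quotientRel_def _).1 ha
    have hb := (Submodule.quotientRel_def _).1 hb
    refine (Submodule.quotientRel_def _).2 ?_
    have h : a * b - a' * b' = (a - a') * b + a' * (b - b') := by
      rw [sub_mul, mul_sub]; abel
    change a * b - a' * b' ∈ _
    rw [h]
    exact add_mem (I.mul_right _ _ ha) (I.mul_left _ _ hb)

theorem mk_mul (x y : E.FreeAlg) : mk E (x * y) = mk E x * mk E y := rfl

instance : NonUnitalRing E.Leavitt where
  left_distrib a b c := by
    obtain ⟨a, rfl⟩ := mk_surjective E a
    obtain ⟨b, rfl⟩ := mk_surjective E b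
    obtain ⟨c, rfl⟩ := mk_surjective E c
    rw [← map_add, ← mk_mul, ← mk_mul, ← mk_mul, ← map_add, mul_add]
  right_distrib a b c := by
    obtain ⟨a, rfl⟩ := mk_surjective E a
    obtain ⟨b, rfl⟩ := mk_surjective E b
    obtain ⟨c, rfl⟩ := mk_surjective E c
    rw [← map_add, ← mk_mul, ← mk_mul, ← mk_mul, ← map_add, add_mul]
  zero_mul a := by
    obtain ⟨a, rfl⟩ := mk_surjective E a
    rw [← map_zero (mk E), ← mk_mul, zero_mul]
  mul_zero a := by
    obtain ⟨a, rfl⟩ := mk_surjective E a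
    rw [← map_zero (mk E), ← mk_mul, mul_zero]
  mul_assoc a b c := by
    obtain ⟨a, rfl⟩ := mk_surjective E a
    obtain ⟨b, rfl⟩ := mk_surjective E b
    obtain ⟨c, rfl⟩ := mk_surjective E c
    simp only [← mk_mul, mul_assoc]

instance : IsScalarTower ℂ E.Leavitt E.Leavitt where
  smul_assoc z a b := by
    obtain ⟨a, rfl⟩ := mk_surjective E a
    obtain ⟨b, rfl⟩ := mk_surjective E b
    change (z • mk E a) * mk E b = z • (mk E a * mk E b)
    rw [← map_smul, ← mk_mul, ← mk_mul, ← map_smul, smul_mul_assoc]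

instance : SMulCommClass ℂ E.Leavitt E.Leavitt where
  smul_comm z a b := by
    obtain ⟨a, rfl⟩ := mk_surjective E a
    obtain ⟨b, rfl⟩ := mk_surjective E b
    change z • (mk E a * mk E b) = mk E a * (z • mk E b)
    rw [← map_smul, ← mk_mul, ← mk_mul, ← map_smul, mul_smul_comm]

instance : Star E.Leavitt where
  star := Quotient.map star fun a a' ha => by
    have ha := E.star_mem_leavittIdeal ((Submodule.quotientRel_def _).1 ha)
    exact (Submodule.quotientRel_def _).2 (by rwa [star_sub] at ha)

theorem mk_star (x : E.FreeAlg) : mk E (star x) = star (mk E x) := rfl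

instance : StarRing E.Leavitt where
  star_involutive a := by
    obtain ⟨a, rfl⟩ := mk_surjective E a
    rw [← mk_star, ← mk_star, star_star]
  star_mul a b := by
    obtain ⟨a, rfl⟩ := mk_surjective E a
    obtain ⟨b, rfl⟩ := mk_surjective E b
    simp only [← mk_mul, ← mk_star, star_mul]
  star_add a b := by
    obtain ⟨a, rfl⟩ := mk_surjective E a
    obtain ⟨b, rfl⟩ := mk_surjective E b
    simp only [← map_add, ← mk_star, star_add]

instance : StarModule ℂ E.Leavitt where
  star_smul z a := by
    obtain ⟨a, rfl⟩ := mk_surjective E a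
    rw [← map_smul, ← mk_star, ← mk_star, star_smul, map_smul]

section lift

variable {B : Type*} [NonUnitalRing B] [StarRing B] [Module ℂ B]

variable {E} in
/-- A *-homomorphism on the free algebra that respects the Leavitt relations descends to
`L_ℂ(E)`. -/
def lift (f : E.FreeAlg →⋆ₙₐ[ℂ] B) (hf : ∀ a b, E.LeavittRel a b → f a = f b) :
    E.Leavitt →⋆ₙₐ[ℂ] B :=
  have hle : E.leavittIdeal ≤ LinearMap.ker (f : E.FreeAlg →ₗ[ℂ] B) := leavittIdeal_le
    { rel := fun a b h => by simp [hf a b h]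
      mul_left := fun a x hx => by
        have hx : f x = 0 := hx
        change f (a * x) = 0
        rw [map_mul, hx, mul_zero]
      mul_right := fun a x hx => by
        have hx : f x = 0 := hx
        change f (x * a) = 0
        rw [map_mul, hx, zero_mul] }
  let φ : E.Leavitt →ₗ[ℂ] B := E.leavittIdeal.liftQ (f : E.FreeAlg →ₗ[ℂ] B) hle
  have hφ : ∀ x, φ (mk E x) = f x := fun _ => rfl
  { toFun := φ
    map_smul' := map_smul φ
    map_zero' := map_zero φ
    map_add' := map_add φ
    map_mul' := fun a b => by
      obtain ⟨a, rfl⟩ := mk_surjective E a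
      obtain ⟨b, rfl⟩ := mk_surjective E b
      rw [← mk_mul, hφ, hφ, hφ, map_mul]
    map_star' := fun a => by
      obtain ⟨a, rfl⟩ := mk_surjective E a
      rw [← mk_star, hφ, hφ, map_star] }

theorem lift_mk (f : E.FreeAlg →⋆ₙₐ[ℂ] B) (hf : ∀ a b, E.LeavittRel a b → f a = f b)
    (x : E.FreeAlg) : lift f hf (mk E x) = f x := rfl

end lift

end Leavitt

/-! ### The graph C*-algebra -/

variable {E} in
/-- A Cuntz-Krieger `E`-family in a *-ring: mutually orthogonal projections `P v` and partial
isometries `S e` with mutually orthogonal ranges that satisfy the Cuntz-Krieger relations. -/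
structure IsCuntzKriegerFamily {R : Type*} [NonUnitalRing R] [StarRing R]
    (P : E.Vert → R) (S : E.Edge → R) : Prop where
  proj_mul_self (v : E.Vert) : P v * P v = P v
  star_proj (v : E.Vert) : star (P v) = P v
  proj_orthogonal (v w : E.Vert) (h : v ≠ w) : P v * P w = 0
  isom (e : E.Edge) : S e * star (S e) * S e = S e
  star_isom (e : E.Edge) : star (S e) * S e * star (S e) = star (S e)
  range_orthogonal (e f : E.Edge) (h : e ≠ f) : star (S e) * S f = 0
  star_mul_self (e : E.Edge) : star (S e) * S e = P (E.r e)
  proj_eq_sum (v : E.Vert) (hne : (E.emits v).Nonempty) (hfin : (E.emits v).Finite) :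
    P v = ∑ e ∈ hfin.toFinset, S e * star (S e)
  range_le (e : E.Edge) : P (E.s e) * (S e * star (S e)) = S e * star (S e)

/-- The same relations, imposed on the symbols `p_v = v`, `s_e = e` of the free algebra
(in which `p_v* = p_v` and `s_e* = e*` hold already). -/
inductive CKRel : E.FreeAlg → E.FreeAlg → Prop
  | proj_mul_self (v : E.Vert) : CKRel (E.vt v * E.vt v) (E.vt v)
  | proj_orthogonal (v w : E.Vert) (h : v ≠ w) : CKRel (E.vt v * E.vt w) 0
  | isom (e : E.Edge) : CKRel (E.ed e * E.gh e * E.ed e) (E.ed e)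
  | star_isom (e : E.Edge) : CKRel (E.gh e * E.ed e * E.gh e) (E.gh e)
  | range_orthogonal (e f : E.Edge) (h : e ≠ f) : CKRel (E.gh e * E.ed f) 0
  | star_mul_self (e : E.Edge) : CKRel (E.gh e * E.ed e) (E.vt (E.r e))
  | proj_eq_sum (v : E.Vert) (hne : (E.emits v).Nonempty) (hfin : (E.emits v).Finite) :
      CKRel (E.vt v) (∑ e ∈ hfin.toFinset, E.ed e * E.gh e)
  | range_le (e : E.Edge) : CKRel (E.vt (E.s e) * (E.ed e * E.gh e)) (E.ed e * E.gh e)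

variable {E} in
/-- `p` is a C*-seminorm on the free *-algebra for which the generators satisfy the
Cuntz-Krieger relations. -/
structure IsCKSeminorm (p : Seminorm ℂ E.FreeAlg) : Prop where
  mul_le : ∀ x y, p (x * y) ≤ p x * p y
  star_mul_self : ∀ x, p (star x * x) = p x * p x
  rel : ∀ a b, E.CKRel a b → p (a - b) = 0

namespace IsCKSeminorm

variable {E} {p : Seminorm ℂ E.FreeAlg}

theorem congr (hp : IsCKSeminorm p) {a b : E.FreeAlg} (h : E.CKRel a b) : p a = p b := by
  have h1 : |p a - p b| ≤ p (a - b) := abs_sub_map_le_sub p a b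
  rw [hp.rel a b h] at h1
  exact sub_eq_zero.1 (abs_nonpos_iff.1 h1)

theorem le_star (hp : IsCKSeminorm p) (x : E.FreeAlg) : p x ≤ p (star x) := by
  by_contra! h
  have h1 := hp.star_mul_self x
  have h2 := hp.mul_le (star x) x
  have h3 : 0 ≤ p (star x) := apply_nonneg p _
  nlinarith

theorem star_eq (hp : IsCKSeminorm p) (x : E.FreeAlg) : p (star x) = p x :=
  le_antisymm (by simpa using hp.le_star (star x)) (hp.le_star x)

theorem vt_le_one (hp : IsCKSeminorm p) (v : E.Vert) : p (E.vt v) ≤ 1 := by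
  have h1 := hp.star_mul_self (E.vt v)
  rw [E.star_vt, hp.congr (.proj_mul_self v)] at h1
  nlinarith

theorem gen_le_one (hp : IsCKSeminorm p) (g : E.Gen) : p (E.gen g) ≤ 1 := by
  have key : ∀ e, p (E.ed e) ≤ 1 := fun e => by
    have h1 := hp.star_mul_self (E.ed e)
    rw [E.star_ed, hp.congr (.star_mul_self e)] at h1
    have h2 := hp.vt_le_one (E.r e)
    nlinarith
  cases g with
  | vert v => exact hp.vt_le_one v
  | edge e => exact key e
  | ghost e =>
    have h := hp.star_eq (E.ed e)
    rw [E.star_ed] at h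
    exact h.le.trans (key e)

theorem word_le_one (hp : IsCKSeminorm p) (w : FreeSemigroup E.Gen) :
    p (MonoidAlgebra.single w 1) ≤ 1 := by
  induction w with
  | ih1 g => exact hp.gen_le_one g
  | ih2 g w h1 h2 =>
    have h3 : (MonoidAlgebra.single (FreeSemigroup.of g * w) 1 : E.FreeAlg)
        = .single (FreeSemigroup.of g) 1 * .single w 1 := by
      rw [MonoidAlgebra.single_mul_single, mul_one]
    rw [h3]
    exact (hp.mul_le _ _).trans (mul_le_one₀ h1 (apply_nonneg p _) h2)

theorem zero : IsCKSeminorm (0 : Seminorm ℂ E.FreeAlg) where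
  mul_le x y := by simp
  star_mul_self x := by simp
  rel a b h := by simp

end IsCKSeminorm

theorem exists_bound (x : E.FreeAlg) : ∃ C : ℝ, ∀ p, IsCKSeminorm p → p x ≤ C := by
  induction x using MonoidAlgebra.induction_linear with
  | zero => exact ⟨0, fun p _ => by simp⟩
  | add x y hx hy =>
    obtain ⟨C, hC⟩ := hx
    obtain ⟨D, hD⟩ := hy
    exact ⟨C + D, fun p hp => (map_add_le_add p x y).trans (add_le_add (hC p hp) (hD p hp))⟩
  | single w c =>
    refine ⟨‖c‖, fun p hp => ?_⟩
    have h : (MonoidAlgebra.single w c : E.FreeAlg) = c • .single w 1 := by simp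
    rw [h, map_smul_eq_mul]
    exact mul_le_of_le_one_right (norm_nonneg c) (hp.word_le_one w)

theorem bddAbove_CKSeminorm : BddAbove {p : Seminorm ℂ E.FreeAlg | IsCKSeminorm p} := by
  choose C hC using E.exists_bound
  refine Seminorm.bddAbove_iff.2 ⟨C, ?_⟩
  rintro _ ⟨p, hp, rfl⟩ x
  exact hC x p hp

/-- The universal C*-seminorm: the supremum of all the C*-seminorms on the free *-algebra for which
the generators satisfy the Cuntz-Krieger relations. -/
def univSeminorm : Seminorm ℂ E.FreeAlg := sSup {p | IsCKSeminorm p}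

variable {E} in
theorem IsCKSeminorm.le_univ {p : Seminorm ℂ E.FreeAlg} (hp : IsCKSeminorm p) (x : E.FreeAlg) :
    p x ≤ E.univSeminorm x :=
  le_csSup E.bddAbove_CKSeminorm hp x

variable {E} in
theorem univSeminorm_le {x : E.FreeAlg} {C : ℝ} (h : ∀ p, IsCKSeminorm p → p x ≤ C) :
    E.univSeminorm x ≤ C := by
  rw [univSeminorm, Seminorm.sSup_apply E.bddAbove_CKSeminorm]
  have : Nonempty {p : Seminorm ℂ E.FreeAlg | IsCKSeminorm p} := ⟨⟨0, IsCKSeminorm.zero⟩⟩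
  exact ciSup_le fun p => h p.1 p.2

theorem isCKSeminorm_univSeminorm : IsCKSeminorm E.univSeminorm where
  mul_le x y := univSeminorm_le fun p hp => (hp.mul_le x y).trans
    (mul_le_mul (hp.le_univ x) (hp.le_univ y) (apply_nonneg p _) (apply_nonneg _ _))
  star_mul_self x := by
    refine le_antisymm (univSeminorm_le fun p hp => ?_) ?_
    · rw [hp.star_mul_self]
      exact mul_self_le_mul_self (apply_nonneg p _) (hp.le_univ x)
    · have h0 : 0 ≤ E.univSeminorm (star x * x) := apply_nonneg _ _
      have h : E.univSeminorm x ≤ √(E.univSeminorm (star x * x)) := univSeminorm_le fun p hp => by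
        refine Real.le_sqrt_of_sq_le ?_
        rw [sq, ← hp.star_mul_self]
        exact hp.le_univ _
      calc _ ≤ √(E.univSeminorm (star x * x)) * √(E.univSeminorm (star x * x)) :=
            mul_self_le_mul_self (apply_nonneg _ _) h
        _ = _ := Real.mul_self_sqrt h0
  rel a b h := le_antisymm (univSeminorm_le fun p hp => (hp.rel a b h).le) (apply_nonneg _ _)

/-- The free *-algebra, equipped with the universal C*-seminorm. -/
def PreCStar : Type (max u v) := E.FreeAlg

namespace PreCStar

instance : NonUnitalRing E.PreCStar := inferInstanceAs (NonUnitalRing E.FreeAlg)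
instance : StarRing E.PreCStar := inferInstanceAs (StarRing E.FreeAlg)
instance : Module ℂ E.PreCStar := inferInstanceAs (Module ℂ E.FreeAlg)
instance : IsScalarTower ℂ E.PreCStar E.PreCStar :=
  inferInstanceAs (IsScalarTower ℂ E.FreeAlg E.FreeAlg)
instance : SMulCommClass ℂ E.PreCStar E.PreCStar :=
  inferInstanceAs (SMulCommClass ℂ E.FreeAlg E.FreeAlg)
instance : StarModule ℂ E.PreCStar := inferInstanceAs (StarModule ℂ E.FreeAlg)

instance : SeminormedAddCommGroup E.PreCStar :=
  AddGroupSeminorm.toSeminormedAddCommGroup (E := E.PreCStar)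
    (Seminorm.toAddGroupSeminorm (𝕜 := ℂ) (E := E.PreCStar) E.univSeminorm)

theorem norm_def (x : E.PreCStar) : ‖x‖ = E.univSeminorm x := rfl

instance : NonUnitalSeminormedRing E.PreCStar where
  dist_eq := dist_eq_norm_neg_add
  norm_mul_le := E.isCKSeminorm_univSeminorm.mul_le

instance : NormedSpace ℂ E.PreCStar where
  norm_smul_le c x := (map_smul_eq_mul E.univSeminorm c x).le

theorem norm_star_mul_self (x : E.PreCStar) : ‖star x * x‖ = ‖x‖ * ‖x‖ :=
  E.isCKSeminorm_univSeminorm.star_mul_self x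

theorem norm_star (x : E.PreCStar) : ‖star x‖ = ‖x‖ := E.isCKSeminorm_univSeminorm.star_eq x

theorem continuous_star : Continuous (star : E.PreCStar → E.PreCStar) :=
  (AddMonoidHomClass.isometry_of_norm (starAddEquiv : E.PreCStar ≃+ E.PreCStar)
    (norm_star E)).continuous

end PreCStar

open UniformSpace

/-- The graph C*-algebra `C*(E)`: the (Hausdorff) completion of the free *-algebra in the universal
C*-seminorm. -/
def CStar : Type (max u v) := Completion E.PreCStar

namespace CStar

instance : NormedAddCommGroup E.CStar := inferInstanceAs (NormedAddCommGroup (Completion E.PreCStar))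
instance : NormedSpace ℂ E.CStar := inferInstanceAs (NormedSpace ℂ (Completion E.PreCStar))
instance : CompleteSpace E.CStar := inferInstanceAs (CompleteSpace (Completion E.PreCStar))

/-- The canonical map of the free *-algebra to its completion. -/
def of : E.PreCStar →L[ℂ] E.CStar := Completion.toComplL

theorem norm_of (x : E.PreCStar) : ‖of E x‖ = ‖x‖ := Completion.norm_coe x

theorem isDenseInducing_of : IsDenseInducing (of E) := Completion.isDenseInducing_coe

theorem denseRange_of : DenseRange (of E) := (isDenseInducing_of E).dense

instance : Mul E.CStar where
  mul x y := ((isDenseInducing_of E).prodMap (isDenseInducing_of E)).extend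
    (fun z : E.PreCStar × E.PreCStar => of E (z.1 * z.2)) (x, y)

theorem of_mul (x y : E.PreCStar) : of E (x * y) = of E x * of E y :=
  (((isDenseInducing_of E).prodMap (isDenseInducing_of E)).extend_eq
    ((of E).continuous.comp continuous_mul) (x, y)).symm

instance : ContinuousMul E.CStar where
  continuous_mul := by
    let m := (AddMonoidHom.mul : E.PreCStar →+ E.PreCStar →+ E.PreCStar).compr₂
      (of E : E.PreCStar →+ E.CStar)
    have h : Continuous fun z : E.PreCStar × E.PreCStar => m z.1 z.2 :=
      (of E).continuous.comp continuous_mul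
    have di : IsDenseInducing (of E : E.PreCStar →+ E.CStar) := isDenseInducing_of E
    exact di.extend_Z_bilin di h

instance : Star E.CStar where
  star := Completion.map (star : E.PreCStar → E.PreCStar)

theorem of_star (x : E.PreCStar) : of E (star x) = star (of E x) :=
  (Completion.map_coe (uniformContinuous_addMonoidHom_of_continuous
    (f := (starAddEquiv : E.PreCStar ≃+ E.PreCStar).toAddMonoidHom)
    (PreCStar.continuous_star E)) x).symm

instance : ContinuousStar E.CStar where
  continuous_star := Completion.continuous_map

variable {E} in
theorem induction₁ {P : E.CStar → Prop} (hP : IsClosed {x | P x})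
    (h : ∀ a, P (of E a)) (x : E.CStar) : P x :=
  isClosed_property (denseRange_of E) hP h x

variable {E} in
theorem induction₂ {P : E.CStar → E.CStar → Prop}
    (hP : IsClosed {z : E.CStar × E.CStar | P z.1 z.2})
    (h : ∀ a b, P (of E a) (of E b)) (x y : E.CStar) : P x y :=
  isClosed_property2 (denseRange_of E) hP h x y

variable {E} in
theorem induction₃ {P : E.CStar → E.CStar → E.CStar → Prop}
    (hP : IsClosed {z : E.CStar × E.CStar × E.CStar | P z.1 z.2.1 z.2.2})
    (h : ∀ a b c, P (of E a) (of E b) (of E c)) (x y z : E.CStar) : P x y z :=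
  isClosed_property3 (denseRange_of E) hP h x y z

instance : NonUnitalNormedRing E.CStar where
  dist_eq := dist_eq_norm_neg_add
  left_distrib := induction₃ (isClosed_eq (by fun_prop) (by fun_prop)) fun a b c => by
    simp only [← map_add, ← of_mul, mul_add]
  right_distrib := induction₃ (isClosed_eq (by fun_prop) (by fun_prop)) fun a b c => by
    simp only [← map_add, ← of_mul, add_mul]
  zero_mul := induction₁ (isClosed_eq (by fun_prop) (by fun_prop)) fun a => by
    rw [← map_zero (of E), ← of_mul, zero_mul]
  mul_zero := induction₁ (isClosed_eq (by fun_prop) (by fun_prop)) fun a => by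
    rw [← map_zero (of E), ← of_mul, mul_zero]
  mul_assoc := induction₃ (isClosed_eq (by fun_prop) (by fun_prop)) fun a b c => by
    simp only [← of_mul, mul_assoc]
  norm_mul_le := induction₂ (isClosed_le (by fun_prop) (by fun_prop)) fun a b => by
    rw [← of_mul, norm_of, norm_of, norm_of]; exact norm_mul_le a b

instance : StarRing E.CStar where
  star_involutive := induction₁ (isClosed_eq (by fun_prop) (by fun_prop)) fun a => by
    rw [← of_star, ← of_star, star_star]
  star_mul := induction₂ (isClosed_eq (by fun_prop) (by fun_prop)) fun a b => by
    simp only [← of_star, ← of_mul, star_mul]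
  star_add := induction₂ (isClosed_eq (by fun_prop) (by fun_prop)) fun a b => by
    simp only [← of_star, ← map_add, star_add]

instance : CStarRing E.CStar where
  norm_mul_self_le := induction₁ (isClosed_le (by fun_prop) (by fun_prop)) fun a => by
    rw [← of_star, ← of_mul, norm_of, norm_of, PreCStar.norm_star_mul_self]

instance : IsScalarTower ℂ E.CStar E.CStar where
  smul_assoc c x y := by
    change (c • x) * y = c • (x * y)
    refine induction₂ (P := fun x y => (c • x) * y = c • (x * y))
      (isClosed_eq ((continuous_fst.const_smul c).mul continuous_snd)
        ((continuous_fst.mul continuous_snd).const_smul c)) (fun a b => ?_) x y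
    rw [← map_smul, ← of_mul, ← of_mul, ← map_smul, smul_mul_assoc]

instance : SMulCommClass ℂ E.CStar E.CStar where
  smul_comm c x y := by
    change c • (x * y) = x * (c • y)
    refine induction₂ (P := fun x y => c • (x * y) = x * (c • y))
      (isClosed_eq ((continuous_fst.mul continuous_snd).const_smul c)
        (continuous_fst.mul (continuous_snd.const_smul c))) (fun a b => ?_) x y
    rw [← map_smul, ← of_mul, ← of_mul, ← map_smul, mul_smul_comm]

instance : StarModule ℂ E.CStar where
  star_smul c x := by
    refine induction₁ (P := fun x => star (c • x) = star c • star x)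
      (isClosed_eq (continuous_id.const_smul c).star (continuous_id.star.const_smul (star c))) (fun a => ?_) x
    rw [← map_smul, ← of_star, ← of_star, star_smul, map_smul]

/-- `C*(E)` is a C*-algebra. -/
instance : NonUnitalCStarAlgebra E.CStar where

/-- The canonical *-homomorphism of the free *-algebra to `C*(E)`. -/
def ofFree : E.FreeAlg →⋆ₙₐ[ℂ] E.CStar where
  toFun := of E
  map_smul' := map_smul (of E)
  map_zero' := map_zero (of E)
  map_add' := map_add (of E)
  map_mul' := of_mul E
  map_star' := of_star E

theorem norm_ofFree (x : E.FreeAlg) : ‖ofFree E x‖ = E.univSeminorm x := norm_of E x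

/-- The generating projections `p_v`. -/
def proj (v : E.Vert) : E.CStar := ofFree E (E.vt v)

/-- The generating partial isometries `s_e`. -/
def isom (e : E.Edge) : E.CStar := ofFree E (E.ed e)

theorem star_isom (e : E.Edge) : star (isom E e) = ofFree E (E.gh e) := by
  rw [isom, ← map_star, star_ed]

variable {E} in
theorem ofFree_eq {a b : E.FreeAlg} (h : E.CKRel a b) : ofFree E a = ofFree E b := by
  rw [← sub_eq_zero, ← map_sub, ← norm_eq_zero, norm_ofFree]
  exact E.isCKSeminorm_univSeminorm.rel a b h

theorem isCuntzKriegerFamily : IsCuntzKriegerFamily (proj E) (isom E) where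
  proj_mul_self v := by simpa only [proj, isom, map_mul] using ofFree_eq (.proj_mul_self v)
  star_proj v := by rw [proj, ← map_star, star_vt]
  proj_orthogonal v w h := by
    simpa only [proj, isom, map_mul, map_zero] using ofFree_eq (.proj_orthogonal v w h)
  isom e := by rw [star_isom]; simpa only [proj, isom, map_mul] using ofFree_eq (.isom e)
  star_isom e := by rw [star_isom]; simpa only [proj, isom, map_mul] using ofFree_eq (.star_isom e)
  range_orthogonal e f h := by
    rw [star_isom]; simpa only [proj, isom, map_mul, map_zero] using ofFree_eq (.range_orthogonal e f h)
  star_mul_self e := by rw [star_isom]; simpa only [proj, isom, map_mul] using ofFree_eq (.star_mul_self e)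
  proj_eq_sum v hne hfin := by
    simp only [star_isom]
    simpa only [proj, isom, map_mul, map_sum] using ofFree_eq (.proj_eq_sum v hne hfin)
  range_le e := by rw [star_isom]; simpa only [proj, isom, map_mul] using ofFree_eq (.range_le e)

end CStar

/-! ### The universal property of `C*(E)` -/

section universal

variable {E} {B : Type*} [NonUnitalCStarAlgebra B] {P : E.Vert → B} {S : E.Edge → B}

/-- The *-homomorphism of the free *-algebra given by a Cuntz-Krieger family. -/
def IsCuntzKriegerFamily.freeLift (h : IsCuntzKriegerFamily P S) : E.FreeAlg →⋆ₙₐ[ℂ] B :=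
  let g : E.Gen → B := fun x => match x with
    | .vert v => P v
    | .edge e => S e
    | .ghost e => star (S e)
  have hg : ∀ x, g x.adj = star (g x) := fun x => by
    cases x with
    | vert v => exact (h.star_proj v).symm
    | edge e => rfl
    | ghost e => exact (star_star _).symm
  let w : FreeSemigroup E.Gen →ₙ* B := FreeSemigroup.lift g
  have hw : ∀ x, w (E.wordAdj x).unop = star (w x) := fun x => by
    induction x with
    | ih1 x => exact hg x
    | ih2 x y h1 h2 =>
      rw [map_mul, MulOpposite.unop_mul, map_mul, map_mul, star_mul, h1, h2]
  let φ : E.FreeAlg →ₙₐ[ℂ] B := MonoidAlgebra.liftMagma ℂ w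
  have hφ : ∀ x c, φ (MonoidAlgebra.single x c) = c • w x := fun x c => by simp [φ]
  { φ with
    map_star' := fun x => by
      change φ (star x) = star (φ x)
      induction x using MonoidAlgebra.induction_linear with
      | zero => simp
      | add x y hx hy => rw [star_add, map_add, map_add, star_add, hx, hy]
      | single x c => rw [star_single, hφ, hφ, star_smul, hw]; rfl }

theorem IsCuntzKriegerFamily.freeLift_gen (h : IsCuntzKriegerFamily P S) :
    (∀ v, h.freeLift (E.vt v) = P v) ∧ (∀ e, h.freeLift (E.ed e) = S e) ∧
      ∀ e, h.freeLift (E.gh e) = star (S e) := by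
  refine ⟨fun v => ?_, fun v => ?_, fun v => ?_⟩ <;>
  · change MonoidAlgebra.liftMagma ℂ _ (MonoidAlgebra.single _ 1) = _
    simp

theorem IsCuntzKriegerFamily.freeLift_rel (h : IsCuntzKriegerFamily P S) {a b : E.FreeAlg}
    (hab : E.CKRel a b) : h.freeLift a = h.freeLift b := by
  obtain ⟨hv, he, hg⟩ := h.freeLift_gen
  cases hab with
  | proj_mul_self v => simpa only [map_mul, hv] using h.proj_mul_self v
  | proj_orthogonal v w hvw => simpa only [map_mul, map_zero, hv] using h.proj_orthogonal v w hvw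
  | isom e => simpa only [map_mul, he, hg] using h.isom e
  | star_isom e => simpa only [map_mul, he, hg] using h.star_isom e
  | range_orthogonal e f hef =>
    simpa only [map_mul, map_zero, he, hg] using h.range_orthogonal e f hef
  | star_mul_self e => simpa only [map_mul, hv, he, hg] using h.star_mul_self e
  | proj_eq_sum v hne hfin => simpa only [map_mul, map_sum, hv, he, hg] using h.proj_eq_sum v hne hfin
  | range_le e => simpa only [map_mul, hv, he, hg] using h.range_le e

theorem IsCuntzKriegerFamily.norm_freeLift_le (h : IsCuntzKriegerFamily P S) (x : E.FreeAlg) :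
    ‖h.freeLift x‖ ≤ E.univSeminorm x := by
  let p : Seminorm ℂ E.FreeAlg := (normSeminorm ℂ B).comp (h.freeLift : E.FreeAlg →ₗ[ℂ] B)
  have hp : IsCKSeminorm p :=
    { mul_le := fun x y => by
        change ‖h.freeLift (x * y)‖ ≤ ‖h.freeLift x‖ * ‖h.freeLift y‖
        rw [map_mul]; exact norm_mul_le _ _
      star_mul_self := fun x => by
        change ‖h.freeLift (star x * x)‖ = ‖h.freeLift x‖ * ‖h.freeLift x‖
        rw [map_mul, map_star]; exact CStarRing.norm_star_mul_self
      rel := fun a b hab => by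
        change ‖h.freeLift (a - b)‖ = 0
        rw [map_sub, h.freeLift_rel hab, sub_self, norm_zero] }
  exact hp.le_univ x

/-- `C*(E)` is universal for Cuntz-Krieger families in C*-algebras. -/
theorem CStar.existsUnique_lift (h : IsCuntzKriegerFamily P S) :
    ∃! φ : E.CStar →⋆ₙₐ[ℂ] B,
      (∀ v, φ (CStar.proj E v) = P v) ∧ ∀ e, φ (CStar.isom E e) = S e := by
  obtain ⟨hv, he, hg⟩ := h.freeLift_gen
  let f : E.PreCStar →+ B := (h.freeLift : E.FreeAlg →ₗ[ℂ] B).toAddMonoidHom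
  have hf : UniformContinuous f := uniformContinuous_addMonoidHom_of_continuous
    (AddMonoidHomClass.continuous_of_bound f 1 fun x => by
      rw [one_mul]; exact h.norm_freeLift_le x)
  let F : E.CStar → B := Completion.extension f
  have hFc : Continuous F := Completion.continuous_extension
  have hF : ∀ x, F (CStar.of E x) = h.freeLift x := fun x => Completion.extension_coe hf x
  let φ : E.CStar →⋆ₙₐ[ℂ] B :=
    { toFun := F
      map_smul' := fun c x => by
        refine CStar.induction₁ (P := fun x => F (c • x) = c • F x)
          (isClosed_eq (hFc.comp (continuous_const_smul c)) (hFc.const_smul c)) (fun a => ?_) x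
        rw [← map_smul, hF, hF]; exact map_smul h.freeLift c a
      map_zero' := by
        rw [← map_zero (CStar.of E), hF]; exact map_zero h.freeLift
      map_add' := CStar.induction₂ (isClosed_eq (hFc.comp continuous_add)
          ((hFc.comp continuous_fst).add (hFc.comp continuous_snd))) fun a b => by
        rw [← map_add, hF, hF, hF]; exact map_add h.freeLift a b
      map_mul' := CStar.induction₂ (isClosed_eq (hFc.comp continuous_mul)
          ((hFc.comp continuous_fst).mul (hFc.comp continuous_snd))) fun a b => by
        rw [← CStar.of_mul, hF, hF, hF]; exact map_mul h.freeLift a b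
      map_star' := CStar.induction₁ (isClosed_eq (hFc.comp continuous_star) hFc.star) fun a => by
        rw [← CStar.of_star, hF, hF]; exact map_star h.freeLift a }
  refine ⟨φ, ⟨fun v => (hF _).trans (hv v), fun e => (hF _).trans (he e)⟩, ?_⟩
  rintro ψ ⟨hψv, hψe⟩
  have key : ∀ g : E.Gen, ψ (CStar.ofFree E (E.gen g)) = h.freeLift (E.gen g) := fun g => by
    cases g with
    | vert v => exact (hψv v).trans (hv v).symm
    | edge e => exact (hψe e).trans (he e).symm
    | ghost e =>
      refine Eq.trans ?_ (hg e).symm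
      change ψ (CStar.ofFree E (E.gh e)) = _
      rw [← CStar.star_isom, map_star, hψe]
  have key2 : (ψ.comp (CStar.ofFree E) : E.FreeAlg →ₙₐ[ℂ] B) = (h.freeLift : E.FreeAlg →ₙₐ[ℂ] B) :=
    MonoidAlgebra.nonUnitalAlgHom_ext' ℂ <| FreeSemigroup.hom_ext <| funext key
  have hψc : Continuous ψ :=
    AddMonoidHomClass.continuous_of_bound ψ 1 fun x => by
      rw [one_mul]; exact NonUnitalStarAlgHom.norm_apply_le ψ x
  refine NonUnitalStarAlgHom.ext fun x => ?_
  refine CStar.induction₁ (P := fun x => ψ x = φ x) (isClosed_eq hψc hFc) (fun a => ?_) x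
  exact (DFunLike.congr_fun key2 a).trans (hF a).symm

end universal

/-! ### The canonical map -/

theorem ofFree_eq_of_leavittRel (a b : E.FreeAlg) (h : E.LeavittRel a b) :
    CStar.ofFree E a = CStar.ofFree E b := by
  have H := CStar.isCuntzKriegerFamily E
  have hse : ∀ e, CStar.proj E (E.s e) * CStar.isom E e = CStar.isom E e := fun e => by
    calc _ = CStar.proj E (E.s e) * (CStar.isom E e * star (CStar.isom E e)) * CStar.isom E e := by
          rw [mul_assoc, H.isom]
      _ = _ := by rw [H.range_le, H.isom]
  have her : ∀ e, CStar.isom E e * CStar.proj E (E.r e) = CStar.isom E e := fun e => by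
    rw [← H.star_mul_self, ← mul_assoc, H.isom]
  cases h with
  | vert_mul_self v => exact CStar.ofFree_eq (.proj_mul_self v)
  | vert_mul_ne v w h => exact CStar.ofFree_eq (.proj_orthogonal v w h)
  | source_mul_edge e => rw [map_mul]; exact hse e
  | edge_mul_range e => rw [map_mul]; exact her e
  | range_mul_ghost e =>
    rw [map_mul, ← CStar.star_isom, ← CStar.proj]
    simpa only [star_mul, H.star_proj] using congrArg star (her e)
  | ghost_mul_source e =>
    rw [map_mul, ← CStar.star_isom, ← CStar.proj]
    simpa only [star_mul, H.star_proj] using congrArg star (hse e)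
  | ghost_mul_edge_self e => exact CStar.ofFree_eq (.star_mul_self e)
  | ghost_mul_edge_ne e f h => exact CStar.ofFree_eq (.range_orthogonal e f h)
  | vert_eq_sum v hne hfin => exact CStar.ofFree_eq (.proj_eq_sum v hne hfin)

/-- The canonical *-homomorphism `ι_E : L_ℂ(E) → C*(E)`. -/
def iota : E.Leavitt →⋆ₙₐ[ℂ] E.CStar :=
  Leavitt.lift (CStar.ofFree E) E.ofFree_eq_of_leavittRel

theorem iota_vert (v : E.Vert) : E.iota (Leavitt.mk E (E.vt v)) = CStar.proj E v := rfl

theorem iota_edge (e : E.Edge) : E.iota (Leavitt.mk E (E.ed e)) = CStar.isom E e := rfl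

end

end DirGraph

/-! ### Partial permutations as operators on `ℓ²` -/

section PartialPermutation

variable {X : Type*}

/-! Three facts carry the equivalence, and `C*(E)` being finite dimensional is the hub through which
they meet.

First, every `p_v` is nonzero in `C*(E)`. Each vertex gets a copy of `ℕ`, split into infinite
branches indexed by the edges it emits; an edge `e` moves the copy at `r(e)` onto its own branch at
`s(e)`. The resulting operators on `ℓ²(E⁰ × ℕ)` form a Cuntz-Krieger family with nonzero
projections, so `CStar.proj_ne_zero` follows from universality. If `C*(E)` is finite dimensional,
the orthogonality relations then make the `p_v` and the `s_e` linearly independent, so `E` is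
finite. A cycle is impossible too: its powers would be eigenvectors of one gauge endomorphism for
infinitely many eigenvalues.

Second, `L_ℂ(E)` has countable dimension because `E` is countable, whereas by Baire a Banach space
of countable dimension is finite dimensional. Hence a real linear surjection `L_ℂ(E) → C*(E)` forces
`C*(E)` to be finite dimensional. An isomorphism of *-rings is automatically real linear: it
preserves positivity, and a positive additive map on `ℝ` is continuous.

Third, if `E` is finite without cycles, paths have bounded length. Expanding `p_v = ∑ s_e s_e*`
repeatedly ends at sinks, so any Cuntz-Krieger family is spanned by products `s_α s_β*` of paths
ending at a common sink. These are matrix units, and the argument is the same in both algebras.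
Conversely, if `L_ℂ(E)` is finite dimensional, its image in `C*(E)` is closed and dense, so `ι_E` is
surjective. -/

theorem PEquiv.ext_mem {f g : X ≃. X} (h : ∀ x y, y ∈ f x ↔ y ∈ g x) : f = g :=
  PEquiv.ext fun x => Option.ext fun y => h x y

/-- For the induced operators this becomes the partial isometry identity. -/
theorem PEquiv.trans_symm_trans (f : X ≃. X) : (f.trans f.symm).trans f = f := by
  refine PEquiv.ext_mem fun x y => ?_
  rw [PEquiv.self_trans_symm]
  simp only [PEquiv.mem_trans, PEquiv.mem_ofSet_iff, Set.mem_ofPred_eq]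
  constructor
  · rintro ⟨_, ⟨rfl, -⟩, h⟩
    exact h
  · intro h
    exact ⟨x, ⟨rfl, Option.isSome_iff_exists.2 ⟨y, h⟩⟩, h⟩

/-- A partial permutation is injective where it is defined, so each coordinate of `a` is counted at
most once. This makes the induced operator a contraction. -/
theorem PEquiv.sum_elim_rpow_le (f : X ≃. X) (a : lp (fun _ : X => ℂ) 2) (s : Finset X) :
    ∑ x ∈ s, ‖(f x).elim 0 a‖ ^ (2 : ENNReal).toReal ≤ ‖a‖ ^ (2 : ENNReal).toReal := by
  classical
  have hd : (s : Set X).PairwiseDisjoint fun x => (f x).toFinset := by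
    intro x _ y _ hxy
    refine Finset.disjoint_left.2 fun z hz hz' => hxy ?_
    exact f.inj (Option.mem_toFinset.1 hz) (Option.mem_toFinset.1 hz')
  calc _ = ∑ x ∈ s, ∑ y ∈ (f x).toFinset, ‖a y‖ ^ (2 : ENNReal).toReal :=
        Finset.sum_congr rfl fun x _ => by cases f x <;> simp
    _ = ∑ y ∈ s.biUnion fun x => (f x).toFinset, ‖a y‖ ^ (2 : ENNReal).toReal :=
        (Finset.sum_biUnion hd).symm
    _ ≤ _ := lp.sum_rpow_le_norm_rpow (by norm_num) a _

/-- The partial isometry of `ℓ²(X)` that a partial permutation of `X` induces by composition. -/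
noncomputable def PEquiv.toOperator (f : X ≃. X) :
    lp (fun _ : X => ℂ) 2 →L[ℂ] lp (fun _ : X => ℂ) 2 :=
  LinearMap.mkContinuous
    { toFun := fun a => ⟨fun x => (f x).elim 0 a, memℓp_gen' (f.sum_elim_rpow_le a)⟩
      map_add' := fun a b => by
        ext x
        simp only [lp.coeFn_add, Pi.add_apply]
        cases f x <;> simp
      map_smul' := fun c a => by
        ext x
        simp only [lp.coeFn_smul, Pi.smul_apply]
        cases f x <;> simp }
    1 fun a => by
      rw [one_mul]
      exact lp.norm_le_of_forall_sum_le (by norm_num) (norm_nonneg a) (f.sum_elim_rpow_le a)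

theorem PEquiv.toOperator_apply (f : X ≃. X) (a : lp (fun _ : X => ℂ) 2) (x : X) :
    f.toOperator a x = (f x).elim 0 a := rfl

/-- Precomposition reverses the order of maps, and `trans` composes from left to right, so the two
reversals cancel. -/
theorem PEquiv.toOperator_mul (f g : X ≃. X) :
    f.toOperator * g.toOperator = (f.trans g).toOperator := by
  ext a x
  change f.toOperator (g.toOperator a) x = _
  rw [PEquiv.toOperator_apply, PEquiv.toOperator_apply]
  change _ = ((f x).bind g).elim 0 a
  cases f x <;> simp [PEquiv.toOperator_apply]

theorem PEquiv.star_toOperator (f : X ≃. X) : star f.toOperator = f.symm.toOperator := by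
  rw [ContinuousLinearMap.star_eq_adjoint]
  refine ((ContinuousLinearMap.eq_adjoint_iff _ _).2 fun a b => ?_).symm
  rw [lp.inner_eq_tsum, lp.inner_eq_tsum]
  have key : ∀ y x, f y = some x ↔ f.symm x = some y := fun y x => f.eq_some_iff.symm
  have hex : ∀ x : Function.support fun y => inner ℂ (a y) (f.toOperator b y),
      ∃ z, f x = some z := fun ⟨y, hy⟩ => by
    rw [Function.mem_support, PEquiv.toOperator_apply] at hy
    refine Option.ne_none_iff_exists'.1 fun h => hy ?_
    rw [h]
    simp
  choose i hi using hex
  -- Both inner products sum over the pairs `(y, x)` with `f y = x`; `i` sends `y` to its partner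
  -- `x`, which exists wherever the summand is nonzero.
  refine tsum_eq_tsum_of_ne_zero_bij i (fun x y h => ?_) (fun x hx => ?_) fun y => ?_
  · exact Subtype.ext (f.inj (hi x) (by rw [h]; exact hi y))
  · rw [Function.mem_support, PEquiv.toOperator_apply] at hx
    cases h : f.symm x with
    | none => simp [h] at hx
    | some y =>
      have h' := (key y x).2 h
      have hy : y ∈ Function.support fun y => inner ℂ (a y) (f.toOperator b y) := by
        rw [Function.mem_support, PEquiv.toOperator_apply, h']
        simpa [h] using hx
      exact ⟨⟨y, hy⟩, Option.some_injective _ ((hi ⟨y, hy⟩).symm.trans h')⟩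
  · rw [PEquiv.toOperator_apply, PEquiv.toOperator_apply, hi, (key _ _).1 (hi y)]
    rfl

theorem PEquiv.toOperator_bot : (⊥ : X ≃. X).toOperator = 0 := by
  ext a x
  rw [PEquiv.toOperator_apply]
  rfl

end PartialPermutation

namespace DirGraph

noncomputable section

variable (E : DirGraph.{u, v})

/-! ### A Cuntz-Krieger family of nonzero projections -/

/-- For a nonempty countable set of edges, finite or infinite, edges times `ℕ` is in bijection with
`ℕ`. One such bijection per emitting vertex partitions its copy of `ℕ` into infinite branches, with
no separate treatment of infinite emitters. -/
theorem exists_branching : ∃ j : E.Edge → ℕ → ℕ,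
    (∀ e f m n, E.s e = E.s f → j e m = j f n → e = f ∧ m = n) ∧
    ∀ v, (E.emits v).Nonempty → ∀ k, ∃ e n, E.s e = v ∧ j e n = k := by
  classical
  have := E.countable_edge
  have J : ∀ v, (E.emits v).Nonempty → (E.emits v × ℕ ≃ ℕ) := fun v hv => by
    have := hv.to_subtype
    have := Classical.choice (nonempty_denumerable (E.emits v × ℕ))
    exact Denumerable.eqv _
  have hne : ∀ e, (E.emits (E.s e)).Nonempty := fun e => ⟨e, rfl⟩
  -- The vertices are kept as variables so that the equation `v = w` can be substituted; `E.s e =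
  -- E.s f` itself cannot be.
  have hJ : ∀ v w (hv : (E.emits v).Nonempty) (hw : (E.emits w).Nonempty) (hvw : v = w) e f m n
      (he : E.s e = v) (hf : E.s f = w), J v hv ⟨⟨e, he⟩, m⟩ = J w hw ⟨⟨f, hf⟩, n⟩ →
      e = f ∧ m = n := by
    rintro v _ hv hw rfl e f m n he hf h
    have h := (J v hv).injective h
    exact ⟨congrArg (fun x => x.1.1) h, congrArg Prod.snd h⟩
  refine ⟨fun e n => J (E.s e) (hne e) ⟨⟨e, rfl⟩, n⟩, fun e f m n hef h => ?_, fun v hv k => ?_⟩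
  · exact hJ _ _ _ _ hef e f m n rfl rfl h
  · obtain ⟨⟨⟨e, he⟩, n⟩, h⟩ := (J v hv).surjective k
    have he' : E.s e = v := he
    subst he'
    exact ⟨e, n, rfl, h⟩

/-- The bijection of `{r(e)} × ℕ` onto its branch in `{s(e)} × ℕ`. -/
def branch {j : E.Edge → ℕ → ℕ}
    (hj : ∀ e f m n, E.s e = E.s f → j e m = j f n → e = f ∧ m = n) (e : E.Edge) :
    E.Vert × ℕ ≃. E.Vert × ℕ := by
  classical
  exact
  { toFun := fun x => if x.1 = E.r e then some (E.s e, j e x.2) else none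
    invFun := fun y => if h : y.1 = E.s e ∧ ∃ n, j e n = y.2 then some (E.r e, h.2.choose) else none
    inv := by
      rintro ⟨v, m⟩ ⟨w, n⟩
      simp only [Option.dite_none_right_eq_some, Option.ite_none_right_eq_some, Option.some.injEq,
        Prod.mk.injEq]
      constructor
      · rintro ⟨h, rfl, rfl⟩
        exact ⟨rfl, h.1.symm, h.2.choose_spec⟩
      · rintro ⟨rfl, rfl, rfl⟩
        have h : ∃ k, j e k = j e m := ⟨m, rfl⟩
        exact ⟨⟨rfl, h⟩, rfl, (hj e e _ _ rfl h.choose_spec).2⟩ }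

theorem mem_branch {j : E.Edge → ℕ → ℕ}
    (hj : ∀ e f m n, E.s e = E.s f → j e m = j f n → e = f ∧ m = n) (e : E.Edge)
    (x y : E.Vert × ℕ) : y ∈ E.branch hj e x ↔ x.1 = E.r e ∧ y = (E.s e, j e x.2) := by
  simp [branch, Option.mem_def, eq_comm]

theorem exists_cuntzKriegerFamily : ∃ (P : E.Vert → (lp (fun _ : E.Vert × ℕ => ℂ) 2 →L[ℂ]
      lp (fun _ : E.Vert × ℕ => ℂ) 2)) (S : E.Edge → _),
    IsCuntzKriegerFamily P S ∧ ∀ v, P v ≠ 0 := by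
  classical
  obtain ⟨j, hj, hj'⟩ := E.exists_branching
  let φ := E.branch hj
  let p : E.Vert → (E.Vert × ℕ ≃. E.Vert × ℕ) := fun v => PEquiv.ofSet {x | x.1 = v}
  have hφ : ∀ e x y, y ∈ φ e x ↔ x.1 = E.r e ∧ y = (E.s e, j e x.2) := E.mem_branch hj
  have hp : ∀ v x y, y ∈ p v x ↔ x = y ∧ x.1 = v := fun v x y => by
    simp only [p, PEquiv.mem_ofSet_iff, Set.mem_ofPred_eq]
    exact ⟨fun h => ⟨h.1.symm, h.1 ▸ h.2⟩, fun h => ⟨h.1.symm, h.1 ▸ h.2⟩⟩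
  have hrange : ∀ e x y, y ∈ (φ e).symm.trans (φ e) x ↔ x = y ∧ x.1 = E.s e ∧ ∃ n, j e n = x.2 := by
    intro e x y
    simp only [PEquiv.mem_trans, PEquiv.mem_iff_mem, hφ]
    constructor
    · rintro ⟨z, ⟨hz, rfl⟩, -, rfl⟩
      exact ⟨rfl, rfl, _, rfl⟩
    · rintro ⟨rfl, h, n, hn⟩
      exact ⟨(E.r e, n), ⟨rfl, Prod.ext h hn.symm⟩, rfl, Prod.ext h hn.symm⟩
  -- Operators act by precomposition, so it is the inverse of `φ e` that carries the basis vector at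
  -- `z` to the one at `φ e z`.
  refine ⟨fun v => (p v).toOperator, fun e => (φ e).symm.toOperator, ?_, fun v hv => ?_⟩
  · have hstar : ∀ e, star (φ e).symm.toOperator = (φ e).toOperator := fun e =>
      (φ e).symm.star_toOperator
    constructor
    · intro v
      rw [PEquiv.toOperator_mul]
      refine congrArg PEquiv.toOperator (PEquiv.ext_mem fun x y => ?_)
      simp only [PEquiv.mem_trans, hp]
      grind
    · intro v
      rw [PEquiv.star_toOperator]
      rfl
    · intro v w h
      rw [PEquiv.toOperator_mul, ← PEquiv.toOperator_bot]
      refine congrArg PEquiv.toOperator (PEquiv.ext_mem fun x y => ?_)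
      simp only [PEquiv.mem_trans, hp]
      simp only [PEquiv.bot_apply, Option.mem_def, reduceCtorEq, iff_false]
      grind
    · intro e
      rw [hstar, PEquiv.toOperator_mul, PEquiv.toOperator_mul]
      exact congrArg _ (φ e).symm.trans_symm_trans
    · intro e
      rw [hstar, PEquiv.toOperator_mul, PEquiv.toOperator_mul]
      exact congrArg _ (φ e).trans_symm_trans
    · intro e f h
      rw [hstar, PEquiv.toOperator_mul, ← PEquiv.toOperator_bot]
      refine congrArg PEquiv.toOperator (PEquiv.ext_mem fun x y => ?_)
      refine iff_of_false ?_ (by simp)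
      simp only [PEquiv.mem_trans, PEquiv.mem_iff_mem, hφ]
      rintro ⟨z, ⟨-, hz⟩, -, hz'⟩
      rw [hz] at hz'
      exact h (hj e f _ _ (congrArg Prod.fst hz') (congrArg Prod.snd hz')).1
    · intro e
      rw [hstar, PEquiv.toOperator_mul]
      refine congrArg PEquiv.toOperator (PEquiv.ext_mem fun x y => ?_)
      simp only [PEquiv.mem_trans, PEquiv.mem_iff_mem, hφ, hp]
      constructor
      · rintro ⟨z, ⟨h, rfl⟩, h', hz'⟩
        exact ⟨Prod.ext (h.trans h'.symm) (hj e e _ _ rfl (congrArg Prod.snd hz')).2, h⟩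
      · rintro ⟨rfl, h⟩
        exact ⟨_, ⟨h, rfl⟩, h, rfl⟩
    · intro v hne hfin
      simp only [hstar, PEquiv.toOperator_mul]
      ext a x
      rw [PEquiv.toOperator_apply, sum_apply, lp.coeFn_sum,
        Finset.sum_apply]
      simp only [PEquiv.toOperator_apply]
      -- A partial permutation that fixes every point of its domain acts as multiplication by an
      -- indicator function. Both sides of the relation are built from such operators, so it can be
      -- checked at each point `x`.
      have hval : ∀ (q : E.Vert × ℕ ≃. E.Vert × ℕ) (c : Prop) [Decidable c],
          (∀ y, y ∈ q x ↔ x = y ∧ c) → (q x).elim 0 a = if c then a x else 0 := by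
        intro q c _ hq
        by_cases hc : c
        · rw [if_pos hc, show q x = some x from (hq x).2 ⟨rfl, hc⟩]
          rfl
        · rw [if_neg hc, Option.eq_none_iff_forall_not_mem.2 fun y hy => hc ((hq y).1 hy).2]
          rfl
      rw [hval (p v) _ (hp v x), Finset.sum_congr rfl fun e _ => hval _ _ (hrange e x)]
      by_cases hx : x.1 = v
      · obtain ⟨e, n, he, hn⟩ := hj' v hne x.2
        rw [if_pos hx, Finset.sum_eq_single_of_mem e (by simpa [emits] using he),
          if_pos ⟨hx.trans he.symm, n, hn⟩]
        rintro f hf hfe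
        refine if_neg ?_
        rintro ⟨hf', m, hm⟩
        exact hfe (hj f e m n (hf'.symm.trans (hx.trans he.symm)) (hm.trans hn.symm)).1
      · rw [if_neg hx, Finset.sum_eq_zero]
        intro e he
        have he : E.s e = v := by simpa [emits] using he
        exact if_neg fun h => hx (h.1.trans he)
    · intro e
      rw [hstar, PEquiv.toOperator_mul, PEquiv.toOperator_mul]
      refine congrArg PEquiv.toOperator (PEquiv.ext_mem fun x y => ?_)
      rw [PEquiv.mem_trans]
      simp only [hp, hrange]
      grind
  · have h := congrArg (fun T => T (lp.single 2 (v, 0) (1 : ℂ)) (v, 0)) hv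
    have h0 : p v (v, 0) = some (v, 0) := (hp v _ _).2 ⟨rfl, rfl⟩
    simp [PEquiv.toOperator_apply, h0] at h

/-- Every linear independence argument rests on this, and through `iota` it also gives nonzero
vertices in the Leavitt path algebra. -/
theorem CStar.proj_ne_zero (v : E.Vert) : CStar.proj E v ≠ 0 := by
  obtain ⟨P, S, h, hP⟩ := E.exists_cuntzKriegerFamily
  obtain ⟨φ, ⟨hφ, -⟩, -⟩ := CStar.existsUnique_lift h
  intro h0
  exact hP v (by rw [← hφ, h0, map_zero])

end

end DirGraph

/-! ### Countable dimension and completeness -/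

/-- A Banach space that is spanned by countably many vectors is finite dimensional. -/
theorem finiteDimensional_of_countable_span {V : Type*} [NormedAddCommGroup V] [NormedSpace ℝ V]
    [CompleteSpace V] {c : Set V} (hc : c.Countable) (hspan : Submodule.span ℝ c = ⊤) :
    FiniteDimensional ℝ V := by
  classical
  have := hc.to_subtype
  let W : Finset c → Submodule ℝ V := fun t => Submodule.span ℝ (t.image Subtype.val : Finset V)
  have hW : ⋃ t, (W t : Set V) = Set.univ := by
    refine Set.eq_univ_of_forall fun x => Set.mem_iUnion.2 ?_
    have hx : x ∈ Submodule.span ℝ c := hspan ▸ Submodule.mem_top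
    obtain ⟨t, ht, hx⟩ := Submodule.mem_span_finite_of_mem_span hx
    refine ⟨t.subtype (· ∈ c), Submodule.span_mono ?_ hx⟩
    intro y hy
    simpa using ⟨hy, ht hy⟩
  -- Baire: the spans of the finite subsets of `c` are countably many closed subspaces covering `V`,
  -- so one has interior and is therefore everything.
  obtain ⟨t, ht⟩ := nonempty_interior_of_iUnion_of_closed
    (fun t => (W t).closed_of_finiteDimensional) hW
  have htop : W t = ⊤ := Submodule.eq_top_of_nonempty_interior' _ ht
  exact Module.finite_def.2 (htop ▸ Submodule.fg_span (Finset.finite_toSet _))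

namespace DirGraph

noncomputable section

variable (E : DirGraph.{u, v})

instance countable_gen : Countable E.Gen := by
  have := E.countable_vert
  have := E.countable_edge
  let f : E.Vert ⊕ E.Edge ⊕ E.Edge → E.Gen :=
    Sum.elim Gen.vert (Sum.elim Gen.edge Gen.ghost)
  refine Function.Surjective.countable (f := f) fun g => ?_
  cases g with
  | vert v => exact ⟨.inl v, rfl⟩
  | edge e => exact ⟨.inr (.inl e), rfl⟩
  | ghost e => exact ⟨.inr (.inr e), rfl⟩

instance countable_word : Countable (FreeSemigroup E.Gen) :=
  Function.Injective.countable (f := fun w : FreeSemigroup E.Gen => (w.head, w.tail))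
    fun a b h => by
      cases a; cases b; simpa using h

/-- The scalars are real because isomorphisms of *-rings are only known to be real linear. Each word
therefore contributes two vectors, itself and its multiple by `I`. -/
theorem Leavitt.exists_countable_span :
    ∃ c : Set E.Leavitt, c.Countable ∧ Submodule.span ℝ c = ⊤ := by
  let f : FreeSemigroup E.Gen × Bool → E.Leavitt := fun w =>
    Leavitt.mk E (.single w.1 (if w.2 then 1 else Complex.I))
  refine ⟨Set.range f, Set.countable_range f, eq_top_iff.2 fun x _ => ?_⟩
  obtain ⟨x, rfl⟩ := Leavitt.mk_surjective E x
  induction x using MonoidAlgebra.induction_linear with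
  | zero => simp
  | add x y hx hy => rw [map_add]; exact add_mem (hx trivial) (hy trivial)
  | single w c =>
    have h : (MonoidAlgebra.single w c : E.FreeAlg)
        = (c.re : ℂ) • .single w 1 + (c.im : ℂ) • .single w Complex.I := by
      rw [MonoidAlgebra.smul_single, MonoidAlgebra.smul_single, ← MonoidAlgebra.single_add]
      simp
    rw [h, map_add, map_smul, map_smul]
    refine add_mem ?_ ?_
    · exact Submodule.smul_mem _ c.re (Submodule.subset_span ⟨(w, true), rfl⟩)
    · exact Submodule.smul_mem _ c.im (Submodule.subset_span ⟨(w, false), rfl⟩)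

theorem CStar.finiteDimensional_of_surjective (φ : E.Leavitt →ₗ[ℝ] E.CStar)
    (hφ : Function.Surjective φ) : FiniteDimensional ℂ E.CStar := by
  obtain ⟨c, hc, hspan⟩ := Leavitt.exists_countable_span E
  have : FiniteDimensional ℝ E.CStar := finiteDimensional_of_countable_span (hc.image φ) (by
    rw [Submodule.span_image, hspan, Submodule.map_top, LinearMap.range_eq_top.2 hφ])
  exact FiniteDimensional.right ℝ ℂ E.CStar

/-! ### Isomorphisms of *-rings are real linear -/

/-- An additive map of the reals to a C*-algebra that carries squares to positive elements is real
linear. -/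
theorem _root_.AddMonoidHom.map_real_of_map_sq {A : Type*} [NonUnitalCStarAlgebra A] (T : ℝ →+ A)
    (hT : ∀ r, ∃ a, T (r * r) = star a * a) (r : ℝ) : T r = r • T 1 := by
  -- In the spectral order, elements of the form `star a * a` are nonnegative, so `T` is positive
  -- and hence monotone in norm on nonnegative reals.
  let _ := CStarAlgebra.spectralOrder A
  have _ := CStarAlgebra.spectralOrderedRing A
  have hpos : ∀ r, 0 ≤ r → 0 ≤ T r := fun r hr => by
    obtain ⟨a, ha⟩ := hT (√r)
    rw [Real.mul_self_sqrt hr] at ha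
    rw [ha]
    exact star_mul_self_nonneg a
  have hmono : ∀ r s, 0 ≤ r → r ≤ s → ‖T r‖ ≤ ‖T s‖ := fun r s hr hrs => by
    refine CStarAlgebra.norm_le_norm_of_nonneg_of_le (hpos r hr) ?_
    rw [← sub_nonneg, ← map_sub]
    exact hpos _ (sub_nonneg.2 hrs)
  have habs : ∀ r s, |r| ≤ s → ‖T r‖ ≤ ‖T s‖ := fun r s h => by
    refine le_trans (le_of_eq ?_) (hmono |r| s (abs_nonneg r) h)
    rcases abs_choice r with h | h <;> simp [h]
  -- On `|x| ≤ 1 / n` the norm of `T x` is at most `‖T (1 / n)‖ = ‖T 1‖ / n`. This gives continuity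
  -- at zero, hence everywhere by additivity.
  have hcont : Continuous T := by
    refine continuous_of_continuousAt_zero T (Metric.continuousAt_iff.2 fun ε hε => ?_)
    obtain ⟨n, hn⟩ := exists_nat_gt (‖T 1‖ / ε)
    have hn0 : (0 : ℝ) < n := (div_nonneg (norm_nonneg _) hε.le).trans_lt hn
    refine ⟨1 / n, by positivity, fun {x} hx => ?_⟩
    rw [map_zero, dist_zero_right]
    rw [dist_zero_right] at hx
    refine (habs x (1 / n) hx.le).trans_lt ?_
    have h1 : (n : ℝ) * ‖T (1 / n)‖ = ‖T 1‖ := by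
      have h2 : T 1 = (n : ℝ) • T (1 / n) := by
        rw [Nat.cast_smul_eq_nsmul, ← map_nsmul, nsmul_eq_mul, mul_one_div_cancel hn0.ne']
      rw [h2, norm_smul, Real.norm_natCast]
    rw [div_lt_iff₀ hε, ← h1] at hn
    exact lt_of_mul_lt_mul_left hn hn0.le
  simpa using (T.toRealLinearMap hcont).map_smul r 1

/-- The sum of finitely many vertices in the free algebra. -/
def vtSum (F : Finset E.Vert) : E.FreeAlg := ∑ v ∈ F, E.vt v

theorem star_vtSum (F : Finset E.Vert) : star (E.vtSum F) = E.vtSum F := by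
  simp [vtSum, star_sum]

theorem Leavitt.mk_eq_of_rel {a b : E.FreeAlg} (h : E.LeavittRel a b) :
    Leavitt.mk E a = Leavitt.mk E b :=
  Leavitt.mk_eq_mk.2 (E.isLeavittIdeal_leavittIdeal.rel a b h)

theorem Leavitt.vtSum_mul {F : Finset E.Vert} {x : E.Leavitt} {v : E.Vert} (hv : v ∈ F)
    (hx : Leavitt.mk E (E.vt v) * x = x) : Leavitt.mk E (E.vtSum F) * x = x := by
  classical
  have h : ∀ w ∈ F, w ≠ v → Leavitt.mk E (E.vt w) * x = 0 := fun w _ hw => by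
    rw [← hx, ← mul_assoc, ← Leavitt.mk_mul, Leavitt.mk_eq_of_rel E (.vert_mul_ne w v hw),
      map_zero, zero_mul]
  rw [vtSum, map_sum, Finset.sum_mul, Finset.sum_eq_single_of_mem v hv h, hx]

theorem Leavitt.vtSum_mul_self (F : Finset E.Vert) :
    Leavitt.mk E (E.vtSum F) * Leavitt.mk E (E.vtSum F) = Leavitt.mk E (E.vtSum F) := by
  have h : Leavitt.mk E (E.vtSum F) * Leavitt.mk E (E.vtSum F)
      = ∑ v ∈ F, Leavitt.mk E (E.vtSum F) * Leavitt.mk E (E.vt v) := by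
    rw [← Finset.mul_sum, ← map_sum]
    rfl
  rw [h, Finset.sum_congr rfl fun v hv => Leavitt.vtSum_mul E hv (by
    rw [← Leavitt.mk_mul, Leavitt.mk_eq_of_rel E (.vert_mul_self v)]), ← map_sum]
  rfl

/-- Finite sums of vertices are local left units of the Leavitt path algebra. -/
theorem Leavitt.exists_local_unit (x : E.Leavitt) :
    ∃ F : Finset E.Vert, ∀ G, F ⊆ G → Leavitt.mk E (E.vtSum G) * x = x := by
  classical
  obtain ⟨x, rfl⟩ := Leavitt.mk_surjective E x
  induction x using MonoidAlgebra.induction_linear with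
  | zero => exact ⟨∅, fun G _ => by simp⟩
  | add x y hx hy =>
    obtain ⟨F, hF⟩ := hx
    obtain ⟨G, hG⟩ := hy
    -- The statement covers all larger finite sets precisely so that one vertex sum can serve both
    -- summands.
    refine ⟨F ∪ G, fun H hH => ?_⟩
    rw [map_add, mul_add, hF H (Finset.union_subset_left hH), hG H (Finset.union_subset_right hH)]
  | single w c =>
    have hgen : ∀ g, ∃ v, Leavitt.mk E (E.vt v) * Leavitt.mk E (E.gen g)
        = Leavitt.mk E (E.gen g) := fun g => by
      cases g with
      | vert v => exact ⟨v, Leavitt.mk_eq_of_rel E (.vert_mul_self v)⟩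
      | edge e => exact ⟨_, Leavitt.mk_eq_of_rel E (.source_mul_edge e)⟩
      | ghost e => exact ⟨_, Leavitt.mk_eq_of_rel E (.range_mul_ghost e)⟩
    have hw : ∃ v, Leavitt.mk E (E.vt v) * Leavitt.mk E (.single w c)
        = Leavitt.mk E (.single w c) := by
      induction w with
      | ih1 g =>
        obtain ⟨v, hv⟩ := hgen g
        have h : (MonoidAlgebra.single (FreeSemigroup.of g) c : E.FreeAlg) = c • E.gen g := by
          simp [gen]
        exact ⟨v, by rw [h, map_smul, mul_smul_comm, hv]⟩
      | ih2 g w h1 h2 =>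
        obtain ⟨v, hv⟩ := hgen g
        have h : (MonoidAlgebra.single (FreeSemigroup.of g * w) c : E.FreeAlg)
            = E.gen g * .single w c := by
          rw [gen, MonoidAlgebra.single_mul_single, one_mul]
        exact ⟨v, by rw [h, Leavitt.mk_mul, ← mul_assoc, hv]⟩
    obtain ⟨v, hv⟩ := hw
    exact ⟨{v}, fun G hG => Leavitt.vtSum_mul E (hG (Finset.mem_singleton_self v)) hv⟩

/-- The algebra may lack a unit, so a projection `p` with `p * x = x` replaces it: `r • x = (r • p)
* x` reduces the claim to the additive map `r ↦ φ (r • p)` on the reals. -/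
theorem Leavitt.starRingEquiv_real_smul (φ : E.Leavitt ≃⋆+* E.CStar) (r : ℝ) (x : E.Leavitt) :
    φ (r • x) = r • φ x := by
  obtain ⟨F, hF⟩ := Leavitt.exists_local_unit E x
  have hx := hF F subset_rfl
  set p := Leavitt.mk E (E.vtSum F) with hp
  have hpp : p * p = p := Leavitt.vtSum_mul_self E F
  have hps : star p = p := by rw [hp, ← Leavitt.mk_star, star_vtSum]
  let T : ℝ →+ E.CStar :=
    { toFun := fun r => φ (r • p)
      map_zero' := by rw [zero_smul, map_zero]
      map_add' := fun r s => by rw [add_smul, map_add] }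
  -- Since `p` is a self-adjoint idempotent, `(r * r) • p` is `star (r • p) * (r • p)`, and `φ`
  -- preserves this form.
  have hT : T r = r • T 1 := T.map_real_of_map_sq (fun r => ⟨φ (r • p), by
    change φ ((r * r) • p) = _
    rw [← map_star, ← map_mul]
    congr 1
    have : star (r • p) = r • p := by
      rw [← Complex.coe_smul, star_smul, hps, ← starRingEnd_apply, Complex.conj_ofReal]
    rw [this, ← Complex.coe_smul, ← Complex.coe_smul, smul_mul_assoc, mul_smul_comm, hpp, smul_smul]
    simp⟩) r
  have hT : φ (r • p) = r • φ p := by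
    have h1 : T 1 = φ p := by
      change φ ((1 : ℝ) • p) = φ p
      rw [one_smul]
    rw [← h1]
    exact hT
  calc φ (r • x) = φ ((r • p) * x) := by
        rw [← Complex.coe_smul, ← Complex.coe_smul, smul_mul_assoc, hx]
    _ = r • φ x := by
        rw [map_mul, hT, ← Complex.coe_smul, ← Complex.coe_smul, smul_mul_assoc, ← map_mul, hx]

theorem CStar.finiteDimensional_of_starRingEquiv (φ : E.Leavitt ≃⋆+* E.CStar) :
    FiniteDimensional ℂ E.CStar :=
  CStar.finiteDimensional_of_surjective E
    { toFun := φ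
      map_add' := map_add φ
      map_smul' := Leavitt.starRingEquiv_real_smul E φ } (EquivLike.surjective φ)

theorem CStar.finiteDimensional_of_iota_surjective (h : Function.Surjective E.iota) :
    FiniteDimensional ℂ E.CStar :=
  CStar.finiteDimensional_of_surjective E
    { toFun := E.iota
      map_add' := map_add E.iota
      map_smul' := fun r x => map_smul E.iota (r : ℂ) x } h

/-! ### Finite dimensional subspaces that contain the image of the free algebra -/

/-- The image of the free algebra is dense, and finite dimensional subspaces are closed. -/
theorem CStar.eq_top_of_ofFree_mem (V : Submodule ℂ E.CStar) [FiniteDimensional ℂ V]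
    (h : ∀ x, CStar.ofFree E x ∈ V) (x : E.CStar) : x ∈ V :=
  CStar.induction₁ (P := fun x => x ∈ V) V.closed_of_finiteDimensional h x

theorem iota_surjective_of_finiteDimensional [FiniteDimensional ℂ E.Leavitt] :
    Function.Surjective E.iota := fun x => by
  let f : E.Leavitt →ₗ[ℂ] E.CStar :=
    { toFun := E.iota
      map_add' := map_add E.iota
      map_smul' := map_smul E.iota }
  exact CStar.eq_top_of_ofFree_mem E (LinearMap.range f) (fun y => ⟨Leavitt.mk E y, rfl⟩) x

end

end DirGraph

namespace DirGraph

noncomputable section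

variable {E : DirGraph.{u, v}}

/-! ### Paths and the elements that they represent -/

/-- `l` is a path that ends at `v`. -/
def EndsAt (v : E.Vert) (l : List E.Edge) : Prop := E.IsPath l ∧ ∀ e ∈ l.getLast?, E.r e = v

/-- The first vertex of a path that ends at `v`. -/
def start (v : E.Vert) : List E.Edge → E.Vert
  | [] => v
  | e :: _ => E.s e

theorem endsAt_nil (v : E.Vert) : EndsAt v ([] : List E.Edge) := by
  simp [EndsAt, IsPath]

theorem endsAt_cons {v : E.Vert} {e : E.Edge} {l : List E.Edge} :
    EndsAt v (e :: l) ↔ E.r e = start v l ∧ EndsAt v l := by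
  cases l with
  | nil => simp [EndsAt, IsPath, start]
  | cons f l => simp [EndsAt, IsPath, start, and_assoc]

theorem EndsAt.append {v w : E.Vert} {k l : List E.Edge} (hk : EndsAt v k) (hl : EndsAt w l)
    (h : start w l = v) : EndsAt w (k ++ l) ∧ start w (k ++ l) = start v k := by
  induction k with
  | nil => exact ⟨hl, h⟩
  | cons e k ih =>
    obtain ⟨h1, h2⟩ := endsAt_cons.1 hk
    obtain ⟨h3, h4⟩ := ih h2
    exact ⟨endsAt_cons.2 ⟨h1.trans h4.symm, h3⟩, rfl⟩

theorem EndsAt.flatten_replicate {v : E.Vert} {l : List E.Edge} (hl : EndsAt v l)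
    (h : start v l = v) (n : ℕ) :
    EndsAt v (List.replicate n l).flatten ∧ start v (List.replicate n l).flatten = v := by
  induction n with
  | zero => exact ⟨endsAt_nil v, rfl⟩
  | succ n ih =>
    rw [List.replicate_succ, List.flatten_cons, ← h]
    have := hl.append ih.1 ih.2
    rw [h]
    exact ⟨this.1, this.2.trans h⟩

/-- Only closedness and positive length of a cycle matter for producing infinitely many paths;
distinctness of the sources is dropped. -/
theorem IsCycle.endsAt {l : List E.Edge} (h : E.IsCycle l) :
    ∃ v, EndsAt v l ∧ start v l = v ∧ l ≠ [] := by
  obtain ⟨hp, ⟨hne, hl⟩, -⟩ := h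
  refine ⟨E.s (l.head hne), ⟨hp, fun e he => ?_⟩, ?_, hne⟩
  · rw [List.getLast?_eq_getLast_of_ne_nil hne, Option.mem_some_iff] at he
    rw [← he, hl]
  · cases l with
    | nil => exact absurd rfl hne
    | cons e l => rfl

/-! ### Multiplication of path elements in a Cuntz-Krieger family -/

section family

variable {R : Type*} [NonUnitalRing R] {P : E.Vert → R} {S : E.Edge → R}

/-- The element `s_{e₁} ⋯ s_{eₙ} p_v` for a list `e₁ … eₙ`. -/
def pathElt (P : E.Vert → R) (S : E.Edge → R) (v : E.Vert) (l : List E.Edge) : R :=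
  l.foldr (fun e x => S e * x) (P v)

theorem pathElt_nil (v : E.Vert) : pathElt P S v [] = P v := rfl

theorem pathElt_cons (v : E.Vert) (e : E.Edge) (l : List E.Edge) :
    pathElt P S v (e :: l) = S e * pathElt P S v l := rfl

variable [StarRing R] (h : IsCuntzKriegerFamily P S)

include h

theorem IsCuntzKriegerFamily.proj_mul_isom (e : E.Edge) : P (E.s e) * S e = S e := by
  calc _ = P (E.s e) * (S e * star (S e)) * S e := by rw [mul_assoc, h.isom]
    _ = _ := by rw [h.range_le, h.isom]

theorem IsCuntzKriegerFamily.isom_mul_proj (e : E.Edge) : S e * P (E.r e) = S e := by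
  rw [← h.star_mul_self, ← mul_assoc, h.isom]

theorem IsCuntzKriegerFamily.proj_mul_isom_of_ne {v : E.Vert} {e : E.Edge} (hv : v ≠ E.s e) :
    P v * S e = 0 := by
  rw [← h.proj_mul_isom, ← mul_assoc, h.proj_orthogonal _ _ hv, zero_mul]

theorem IsCuntzKriegerFamily.pathElt_mul_proj (v : E.Vert) (l : List E.Edge) :
    pathElt P S v l * P v = pathElt P S v l := by
  induction l with
  | nil => exact h.proj_mul_self v
  | cons e l ih => rw [pathElt_cons, mul_assoc, ih]

theorem IsCuntzKriegerFamily.proj_start_mul_pathElt (v : E.Vert) (l : List E.Edge) :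
    P (start v l) * pathElt P S v l = pathElt P S v l := by
  cases l with
  | nil => exact h.proj_mul_self v
  | cons e l => rw [pathElt_cons, ← mul_assoc, start, h.proj_mul_isom]

theorem IsCuntzKriegerFamily.isom_mul_pathElt {v : E.Vert} {e : E.Edge} {l : List E.Edge}
    (hl : E.r e ≠ start v l) : S e * pathElt P S v l = 0 := by
  rw [← h.proj_start_mul_pathElt, ← h.isom_mul_proj, mul_assoc, ← mul_assoc (P _),
    h.proj_orthogonal _ _ hl, zero_mul, mul_zero]

/-- The first edges meet as `star (S e) * S f`. This vanishes for distinct edges; for equal ones it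
is the projection at `r(e)`, which is absorbed because the rest of the path starts there. -/
theorem IsCuntzKriegerFamily.star_pathElt_cons_mul {v w : E.Vert} {e f : E.Edge}
    {k l : List E.Edge} (hl : EndsAt w (f :: l)) :
    (e = f → star (pathElt P S v (e :: k)) * pathElt P S w (f :: l)
      = star (pathElt P S v k) * pathElt P S w l) ∧
    (e ≠ f → star (pathElt P S v (e :: k)) * pathElt P S w (f :: l) = 0) := by
  have hassoc : star (pathElt P S v (e :: k)) * pathElt P S w (f :: l)
      = star (pathElt P S v k) * ((star (S e) * S f) * pathElt P S w l) := by
    rw [pathElt_cons, pathElt_cons, star_mul]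
    simp only [mul_assoc]
  constructor
  · rintro rfl
    rw [hassoc, h.star_mul_self, (endsAt_cons.1 hl).1, h.proj_start_mul_pathElt]
  · intro hef
    rw [hassoc, h.range_orthogonal _ _ hef, zero_mul, mul_zero]

theorem IsCuntzKriegerFamily.star_pathElt_mul_self {v : E.Vert} {l : List E.Edge}
    (hl : EndsAt v l) : star (pathElt P S v l) * pathElt P S v l = P v := by
  induction l with
  | nil => rw [pathElt_nil, h.star_proj, h.proj_mul_self]
  | cons e l ih => rw [(h.star_pathElt_cons_mul hl).1 rfl, ih (endsAt_cons.1 hl).2]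

theorem IsCuntzKriegerFamily.proj_mul_pathElt_of_isSink {v w : E.Vert} (hv : E.IsSink v)
    {f : E.Edge} {l : List E.Edge} : P v * pathElt P S w (f :: l) = 0 := by
  rw [pathElt_cons, ← mul_assoc, h.proj_mul_isom_of_ne, zero_mul]
  rintro rfl
  exact (Set.eq_empty_iff_forall_notMem.1 hv) f rfl

/-- Common initial edges cancel until the edges differ or one path is exhausted. An exhausted path
leaves the projection at a sink, which kills any remaining edge of the other path. The condition `v
= w → k ≠ l` is needed because an empty list does not record its vertex. -/
theorem IsCuntzKriegerFamily.star_pathElt_mul_of_ne {v w : E.Vert} {k l : List E.Edge}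
    (hv : E.IsSink v) (hw : E.IsSink w) (hk : EndsAt v k) (hl : EndsAt w l)
    (hne : v = w → k ≠ l) : star (pathElt P S v k) * pathElt P S w l = 0 := by
  induction k generalizing l with
  | nil =>
    cases l with
    | nil =>
      rw [pathElt_nil, pathElt_nil, h.star_proj, h.proj_orthogonal]
      exact fun hvw => hne hvw rfl
    | cons f l => rw [pathElt_nil, h.star_proj, h.proj_mul_pathElt_of_isSink hv]
  | cons e k ih =>
    cases l with
    | nil =>
      rw [← star_star (pathElt P S w []), ← star_mul, pathElt_nil, h.star_proj,
        h.proj_mul_pathElt_of_isSink hw, star_zero]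
    | cons f l =>
      by_cases hef : e = f
      · rw [(h.star_pathElt_cons_mul hl).1 hef]
        subst hef
        exact ih (endsAt_cons.1 hk).2 (endsAt_cons.1 hl).2 fun hvw hkl => hne hvw (by rw [hkl])
      · exact (h.star_pathElt_cons_mul hl).2 hef

end family

/-! ### Finite dimensional graph C*-algebras -/

/-- The gauge action twists a Cuntz-Krieger family by a scalar of modulus one. -/
theorem IsCuntzKriegerFamily.gauge {B : Type*} [NonUnitalCStarAlgebra B] {P : E.Vert → B}
    {S : E.Edge → B} (h : IsCuntzKriegerFamily P S) {z : ℂ} (hz : ‖z‖ = 1) :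
    IsCuntzKriegerFamily P (fun e => z • S e) := by
  have h1 : z * star z = 1 := by
    rw [← starRingEnd_apply, Complex.mul_conj, Complex.normSq_eq_norm_sq, hz]
    simp
  have h2 : star z * z = 1 := by rw [mul_comm, h1]
  constructor
  · exact h.proj_mul_self
  · exact h.star_proj
  · exact h.proj_orthogonal
  · intro e
    simp only [star_smul, smul_mul_assoc, mul_smul_comm, smul_smul, h.isom]
    rw [h2, mul_one]
  · intro e
    simp only [star_smul, smul_mul_assoc, mul_smul_comm, smul_smul, h.star_isom]
    rw [h1, mul_one]
  · intro e f hef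
    simp only [star_smul, smul_mul_assoc, mul_smul_comm, h.range_orthogonal e f hef, smul_zero]
  · intro e
    simp only [star_smul, smul_mul_assoc, mul_smul_comm, smul_smul, h1, one_smul,
      h.star_mul_self]
  · intro v hne hfin
    simp only [star_smul, smul_mul_assoc, mul_smul_comm, smul_smul, h2, one_smul]
    exact h.proj_eq_sum v hne hfin
  · intro e
    simp only [star_smul, smul_mul_assoc, mul_smul_comm, smul_smul, h2, one_smul, h.range_le]

/-- Vectors with a biorthogonal system of multipliers are linearly independent. -/
theorem _root_.linearIndependent_of_mul_eq_zero {K A ι : Type*} [Field K] [NonUnitalRing A]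
    [Module K A] [SMulCommClass K A A] (x y : ι → A) (h : ∀ i, y i * x i ≠ 0)
    (h0 : ∀ i j, i ≠ j → y i * x j = 0) : LinearIndependent K x := by
  refine linearIndependent_iff'.2 fun s g hg i hi => ?_
  have h1 := congrArg (y i * ·) hg
  simp only [Finset.mul_sum, mul_zero, mul_smul_comm] at h1
  rw [Finset.sum_eq_single_of_mem i hi fun j _ hj => by rw [h0 i j hj.symm, smul_zero]] at h1
  exact (smul_eq_zero.1 h1).resolve_right (h i)

/-- This provides a point of infinite order on the unit circle: a coincidence of two different
powers would make `π` rational. -/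
theorem _root_.Complex.exp_I_pow_injective :
    Function.Injective fun n : ℕ => Complex.exp Complex.I ^ n := by
  intro m n hmn
  simp only [← Complex.exp_nat_mul] at hmn
  obtain ⟨k, hk⟩ := Complex.exp_eq_exp_iff_exists_int.1 hmn
  have hk : (m : ℝ) = n + k * (2 * Real.pi) := by
    have := congrArg Complex.im hk
    simpa using this
  by_cases hk0 : k = 0
  · simpa [hk0] using hk
  · refine (irrational_pi ?_).elim
    refine ⟨(m - n) / (2 * k), ?_⟩
    have hk0 : (k : ℝ) ≠ 0 := by exact_mod_cast hk0
    push_cast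
    rw [div_eq_iff (by positivity), hk]
    ring

variable (E)

theorem isFinite_of_finiteDimensional [FiniteDimensional ℂ E.CStar] : E.IsFinite := by
  have H := CStar.isCuntzKriegerFamily E
  constructor
  · have : LinearIndependent ℂ (CStar.proj E) :=
      linearIndependent_of_mul_eq_zero _ (CStar.proj E)
        (fun v => by rw [H.proj_mul_self]; exact CStar.proj_ne_zero E v) H.proj_orthogonal
    exact this.finite
  · have : LinearIndependent ℂ (CStar.isom E) :=
      linearIndependent_of_mul_eq_zero _ (fun e => star (CStar.isom E e))
        (fun e => by rw [H.star_mul_self]; exact CStar.proj_ne_zero E _) H.range_orthogonal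
    exact this.finite

theorem noCycles_of_finiteDimensional [FiniteDimensional ℂ E.CStar] : E.NoCycles := by
  intro l hl
  obtain ⟨v, hlv, hv, hne⟩ := hl.endsAt
  have H := CStar.isCuntzKriegerFamily E
  have hz : ‖Complex.exp Complex.I‖ = 1 := by simpa using Complex.norm_exp_ofReal_mul_I 1
  obtain ⟨γ, ⟨hγv, hγe⟩, -⟩ := CStar.existsUnique_lift (H.gauge hz)
  have hγ : ∀ k, γ (pathElt (CStar.proj E) (CStar.isom E) v k)
      = Complex.exp Complex.I ^ k.length • pathElt (CStar.proj E) (CStar.isom E) v k := fun k => by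
    induction k with
    | nil => simp [pathElt_nil, hγv]
    | cons e k ih =>
      rw [pathElt_cons, map_mul, ih, hγe, smul_mul_assoc, mul_smul_comm, smul_smul,
        List.length_cons, pow_succ']
  let f : Module.End ℂ E.CStar :=
    { toFun := γ
      map_add' := map_add γ
      map_smul' := map_smul γ }
  -- The `n`-th power of the closed path has eigenvalue `exp(I)` to the power `n * l.length`. These
  -- are distinct since `l` is nonempty, and the vectors are nonzero since `star x * x` is `p_v`.
  have hli := Module.End.eigenvectors_linearIndependent' f
    (fun n : ℕ => Complex.exp Complex.I ^ (n * l.length))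
    (fun m n hmn => Nat.eq_of_mul_eq_mul_right (List.length_pos_iff.2 hne)
      (Complex.exp_I_pow_injective hmn))
    (fun n => pathElt (CStar.proj E) (CStar.isom E) v (List.replicate n l).flatten) (fun n => by
      rw [Module.End.hasEigenvector_iff, Module.End.mem_eigenspace_iff]
      refine ⟨(hγ _).trans (by simp), fun h0 => CStar.proj_ne_zero E v ?_⟩
      rw [← H.star_pathElt_mul_self (hlv.flatten_replicate hv n).1, h0, mul_zero])
  have := hli.finite
  exact not_finite ℕ

end

end DirGraph

namespace DirGraph

noncomputable section

variable {E : DirGraph.{u, v}}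

/-! ### Paths in graphs without cycles -/

/-- Suppose the source of the first edge recurs while the sources of the tail are distinct. Cutting
the path just before the recurrence gives a closed path with distinct sources, that is, a cycle. -/
theorem NoCycles.nodup_source (hE : E.NoCycles) {v : E.Vert} {l : List E.Edge}
    (hl : EndsAt v l) : (l.map E.s).Nodup := by
  induction l with
  | nil => simp
  | cons e l ih =>
    have ih := ih (endsAt_cons.1 hl).2
    rw [List.map_cons, List.nodup_cons]
    refine ⟨fun he => ?_, ih⟩
    obtain ⟨f, hf, hfe⟩ := List.mem_map.1 he
    obtain ⟨k, m, rfl⟩ := List.append_of_mem hf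
    rw [List.map_append, List.map_cons, List.nodup_append] at ih
    obtain ⟨hk, -, hkm⟩ := ih
    have hp : E.IsPath ((e :: k) ++ f :: m) := hl.1
    obtain ⟨hp1, -, hp2⟩ := List.isChain_append.1 hp
    refine hE (e :: k) ⟨hp1, ⟨List.cons_ne_nil e k, ?_⟩, ?_⟩
    · rw [List.head_cons, ← hfe]
      exact hp2 _ (List.getLast?_eq_getLast_of_ne_nil _ ▸ rfl) f rfl
    · rw [List.map_cons, List.nodup_cons]
      exact ⟨fun h => hkm _ h (E.s f) List.mem_cons_self hfe.symm, hk⟩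

theorem NoCycles.length_le (hE : E.NoCycles) [Finite E.Vert] {v : E.Vert} {l : List E.Edge}
    (hl : EndsAt v l) : l.length ≤ Nat.card E.Vert := by
  have := Fintype.ofFinite E.Vert
  rw [Nat.card_eq_fintype_card, ← List.length_map (f := E.s)]
  exact (hE.nodup_source hl).length_le_card

theorem NoCycles.finite_pathTo (hE : E.NoCycles) (hf : E.IsFinite) (v : E.Vert) :
    Finite (E.PathTo v) := by
  have := hf.1
  have := hf.2
  refine ((List.finite_length_le E.Edge (Nat.card E.Vert)).subset fun l hl => ?_).to_subtype
  exact hE.length_le hl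

/-! ### Matrix units -/

section matrixUnits

variable {R : Type*} [NonUnitalRing R] [StarRing R] [Module ℂ R] [IsScalarTower ℂ R R]
  [SMulCommClass ℂ R R] [StarModule ℂ R]

/-- Columns of partial isometries with orthogonal ranges and equal sources in each block. -/
structure IsColumnSystem {D : Type*} {n : D → ℕ} (p : D → R) (x : (d : D) → Fin (n d) → R) :
    Prop where
  ne_zero (d : D) : p d ≠ 0
  mul_proj (d : D) (i : Fin (n d)) : x d i * p d = x d i
  star_mul_self (d : D) (i : Fin (n d)) : star (x d i) * x d i = p d
  star_mul_of_ne (d : D) (i j : Fin (n d)) (h : i ≠ j) : star (x d i) * x d j = 0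
  star_mul_of_block_ne (d c : D) (i : Fin (n d)) (j : Fin (n c)) (h : d ≠ c) :
    star (x d i) * x c j = 0

variable {D : Type*} [Fintype D] {n : D → ℕ}

/-- The linear map that sends matrices to combinations of matrix units. -/
def matrixMap (x : (d : D) → Fin (n d) → R) :
    ((d : D) → Matrix (Fin (n d)) (Fin (n d)) ℂ) →ₗ[ℂ] R where
  toFun M := ∑ d, ∑ i, ∑ j, M d i j • (x d i * star (x d j))
  map_add' M N := by
    simp only [Pi.add_apply, Matrix.add_apply, add_smul, Finset.sum_add_distrib]
  map_smul' c M := by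
    simp only [Pi.smul_apply, Matrix.smul_apply, Finset.smul_sum, smul_assoc, RingHom.id_apply]

omit [IsScalarTower ℂ R R] [SMulCommClass ℂ R R] [StarModule ℂ R] in
theorem matrixMap_apply (x : (d : D) → Fin (n d) → R)
    (M : (d : D) → Matrix (Fin (n d)) (Fin (n d)) ℂ) :
    matrixMap x M = ∑ d, ∑ i, ∑ j, M d i j • (x d i * star (x d j)) := rfl

omit [IsScalarTower ℂ R R] [SMulCommClass ℂ R R] [StarModule ℂ R] in
theorem matrixUnit_mem_range (x : (d : D) → Fin (n d) → R) (d : D) (i j : Fin (n d)) :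
    x d i * star (x d j) ∈ LinearMap.range (matrixMap x) := by
  classical
  refine ⟨Pi.single d (Matrix.single i j 1), ?_⟩
  rw [matrixMap_apply, Finset.sum_eq_single_of_mem d (Finset.mem_univ d), Pi.single_eq_same,
    Finset.sum_eq_single_of_mem i (Finset.mem_univ i),
    Finset.sum_eq_single_of_mem j (Finset.mem_univ j), Matrix.single_apply_same, one_smul]
  · intro k _ hk
    rw [Matrix.single_apply_of_ne _ _ _ _ _ (by simp [hk.symm]), zero_smul]
  · intro k _ hk
    refine Finset.sum_eq_zero fun l _ => ?_
    rw [Matrix.single_apply_of_ne _ _ _ _ _ (by simp [hk.symm]), zero_smul]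
  · intro c _ hc
    simp [Pi.single_eq_of_ne hc]

omit [IsScalarTower ℂ R R] [SMulCommClass ℂ R R] in
theorem matrixMap_star (x : (d : D) → Fin (n d) → R)
    (M : (d : D) → Matrix (Fin (n d)) (Fin (n d)) ℂ) :
    matrixMap x (star M) = star (matrixMap x M) := by
  simp only [matrixMap_apply, star_sum, star_smul, star_mul, star_star]
  refine Finset.sum_congr rfl fun d _ => ?_
  rw [Finset.sum_comm]
  rfl

variable {p : D → R} {x : (d : D) → Fin (n d) → R} (h : IsColumnSystem p x)

include h

omit [SMulCommClass ℂ R R] [StarModule ℂ R] in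
-- The image of `M` acts on the columns `x d k` as `M` acts on basis vectors. Multiplicativity and
-- injectivity of `matrixMap` are both read off from this action.
theorem IsColumnSystem.matrixMap_mul_column (M : (d : D) → Matrix (Fin (n d)) (Fin (n d)) ℂ)
    (d : D) (k : Fin (n d)) : matrixMap x M * x d k = ∑ i, M d i k • x d i := by
  simp only [matrixMap_apply, Finset.sum_mul, smul_mul_assoc, mul_assoc]
  rw [Finset.sum_eq_single_of_mem d (Finset.mem_univ d)]
  · refine Finset.sum_congr rfl fun i _ => ?_
    rw [Finset.sum_eq_single_of_mem k (Finset.mem_univ k), h.star_mul_self, h.mul_proj]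
    intro j _ hj
    rw [h.star_mul_of_ne d j k hj, mul_zero, smul_zero]
  · intro c _ hc
    refine Finset.sum_eq_zero fun i _ => Finset.sum_eq_zero fun j _ => ?_
    rw [h.star_mul_of_block_ne c d j k hc, mul_zero, smul_zero]

omit [StarModule ℂ R] in
theorem IsColumnSystem.matrixMap_mul (M N : (d : D) → Matrix (Fin (n d)) (Fin (n d)) ℂ) :
    matrixMap x (M * N) = matrixMap x M * matrixMap x N := by
  conv_rhs => rw [matrixMap_apply x N]
  simp only [Finset.mul_sum, mul_smul_comm, ← mul_assoc, h.matrixMap_mul_column, Finset.sum_mul,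
    smul_mul_assoc, Finset.smul_sum, smul_smul]
  rw [matrixMap_apply]
  refine Finset.sum_congr rfl fun d _ => ?_
  simp only [Pi.mul_apply, Matrix.mul_apply, Finset.sum_smul]
  calc _ = ∑ i, ∑ k, ∑ j, (M d i k * N d k j) • (x d i * star (x d j)) :=
        Finset.sum_congr rfl fun i _ => Finset.sum_comm
    _ = ∑ k, ∑ i, ∑ j, (M d i k * N d k j) • (x d i * star (x d j)) := Finset.sum_comm
    _ = _ := Finset.sum_congr rfl fun k _ => by
        rw [Finset.sum_comm]
        simp only [mul_comm (N d k _)]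

omit [StarModule ℂ R] in
theorem IsColumnSystem.matrixMap_injective : Function.Injective (matrixMap x) := by
  refine (injective_iff_map_eq_zero _).2 fun M hM => ?_
  ext d i k
  have h1 := h.matrixMap_mul_column M d k
  rw [hM, zero_mul] at h1
  -- Multiplying by `star (x d i)` isolates the entry `M d i k` as the coefficient of the nonzero `p
  -- d`.
  have h2 := congrArg (star (x d i) * ·) h1
  simp only [mul_zero, Finset.mul_sum, mul_smul_comm] at h2
  rw [Finset.sum_eq_single_of_mem i (Finset.mem_univ i) fun j _ hj => by
    rw [h.star_mul_of_ne d i j hj.symm, smul_zero], h.star_mul_self] at h2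
  exact (smul_eq_zero.1 h2.symm).resolve_right (h.ne_zero d)

/-- The *-homomorphism that sends matrices to combinations of matrix units. -/
def IsColumnSystem.matrixHom :
    ((d : D) → Matrix (Fin (n d)) (Fin (n d)) ℂ) →⋆ₙₐ[ℂ] R :=
  { matrixMap x with
    map_zero' := (matrixMap x).map_zero
    map_mul' := h.matrixMap_mul
    map_star' := matrixMap_star x }

end matrixUnits

/-! ### The matrix decomposition for finite graphs without cycles -/

section decomposition

variable {R : Type*} [NonUnitalRing R] [StarRing R] [Module ℂ R] [IsScalarTower ℂ R R]
  [SMulCommClass ℂ R R] [StarModule ℂ R] {P : E.Vert → R} {S : E.Edge → R}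
  [hfin : ∀ v, Finite (E.PathTo v)]

variable (E) in
/-- An enumeration of the paths that end at `v`. -/
def pathEquiv (v : E.Vert) : E.PathTo v ≃ Fin (E.numPathsTo v) := Finite.equivFin _

/-- The elements of the paths that end at the sinks. -/
def pathColumn (P : E.Vert → R) (S : E.Edge → R) (v : {v : E.Vert // E.IsSink v})
    (i : Fin (E.numPathsTo v)) : R :=
  pathElt P S v ((E.pathEquiv v).symm i).1

omit [Module ℂ R] [IsScalarTower ℂ R R] [SMulCommClass ℂ R R] [StarModule ℂ R] in
theorem IsCuntzKriegerFamily.isColumnSystem (h : IsCuntzKriegerFamily P S) (h0 : ∀ v, P v ≠ 0) :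
    IsColumnSystem (fun v : {v : E.Vert // E.IsSink v} => P v) (pathColumn P S) where
  ne_zero d := h0 d
  mul_proj _ _ := h.pathElt_mul_proj _ _
  star_mul_self _ i := h.star_pathElt_mul_self ((E.pathEquiv _).symm i).2
  star_mul_of_ne d i j hij := h.star_pathElt_mul_of_ne d.2 d.2 ((E.pathEquiv _).symm i).2
    ((E.pathEquiv _).symm j).2 fun _ hc => hij ((E.pathEquiv _).symm.injective (Subtype.ext hc))
  star_mul_of_block_ne d c i j hdc := h.star_pathElt_mul_of_ne d.2 c.2
    ((E.pathEquiv _).symm i).2 ((E.pathEquiv _).symm j).2 fun hc => (hdc (Subtype.ext hc)).elim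

variable [Fintype {v : E.Vert // E.IsSink v}]

omit [IsScalarTower ℂ R R] [SMulCommClass ℂ R R] [StarModule ℂ R] in
theorem pathElt_mul_star_mem_range {v : E.Vert} (hv : E.IsSink v) {k l : List E.Edge}
    (hk : EndsAt v k) (hl : EndsAt v l) :
    pathElt P S v k * star (pathElt P S v l) ∈ LinearMap.range (matrixMap (pathColumn P S)) := by
  have key : ∀ a b : E.PathTo v, pathElt P S v a.1 * star (pathElt P S v b.1)
      ∈ LinearMap.range (matrixMap (pathColumn P S)) := fun a b => by
    have h := matrixUnit_mem_range (pathColumn P S) ⟨v, hv⟩ (E.pathEquiv v a) (E.pathEquiv v b)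
    change pathElt P S v ((E.pathEquiv v).symm (E.pathEquiv v a)).1
      * star (pathElt P S v ((E.pathEquiv v).symm (E.pathEquiv v b)).1) ∈ _ at h
    rwa [Equiv.symm_apply_apply, Equiv.symm_apply_apply] at h
  exact key ⟨k, hk⟩ ⟨l, hl⟩

omit [IsScalarTower ℂ R R] [SMulCommClass ℂ R R] in
theorem star_mem_range_matrixMap {a : R}
    (ha : a ∈ LinearMap.range (matrixMap (pathColumn P S))) :
    star a ∈ LinearMap.range (matrixMap (pathColumn P S)) := by
  obtain ⟨M, rfl⟩ := ha
  exact ⟨star M, matrixMap_star _ M⟩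

omit [IsScalarTower ℂ R R] [StarModule ℂ R] in
-- Prepending `e` to a path into a sink gives either another path into the same sink or, if the
-- vertices do not match, the zero element.
theorem IsCuntzKriegerFamily.isom_mul_mem_range (h : IsCuntzKriegerFamily P S) (e : E.Edge) {a : R}
    (ha : a ∈ LinearMap.range (matrixMap (pathColumn P S))) :
    S e * a ∈ LinearMap.range (matrixMap (pathColumn P S)) := by
  obtain ⟨M, rfl⟩ := ha
  rw [matrixMap_apply]
  simp only [Finset.mul_sum, mul_smul_comm]
  refine Submodule.sum_mem _ fun d _ => Submodule.sum_mem _ fun i _ => Submodule.sum_mem _ fun j _ =>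
    Submodule.smul_mem _ _ ?_
  rw [← mul_assoc, pathColumn, pathColumn]
  by_cases hs : E.r e = start (d : E.Vert) ((E.pathEquiv d).symm i).1
  · rw [← pathElt_cons]
    exact pathElt_mul_star_mem_range d.2 (endsAt_cons.2 ⟨hs, ((E.pathEquiv _).symm i).2⟩)
      ((E.pathEquiv _).symm j).2
  · rw [h.isom_mul_pathElt hs, zero_mul]
    exact zero_mem _

omit [IsScalarTower ℂ R R] in
-- The relation `P v = ∑ S e * star (S e)` passes from `v` to the ranges of its edges. The induction
-- follows a path `l` from the initial vertex to the current `v`; `n` bounds how far its length can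
-- still fall short of the number of vertices.
theorem IsCuntzKriegerFamily.proj_mem_range (h : IsCuntzKriegerFamily P S) (hE : E.NoCycles)
    (hf : E.IsFinite) (v : E.Vert) : P v ∈ LinearMap.range (matrixMap (pathColumn P S)) := by
  have := hf.1
  have := hf.2
  suffices H : ∀ n v l, EndsAt v l → Nat.card E.Vert ≤ l.length + n →
      P v ∈ LinearMap.range (matrixMap (pathColumn P S)) from
    H _ v [] (endsAt_nil v) (Nat.le_add_left _ _)
  intro n
  induction n with
  | zero =>
    intro v l hl hn
    -- Here `l` already has the maximal possible length, so an edge leaving `v` would extend it to a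
    -- path that is too long.
    have hv : E.IsSink v := by
      refine Set.eq_empty_iff_forall_notMem.2 fun e he => ?_
      have he : E.s e = v := he
      have := hE.length_le (hl.append (endsAt_cons.2 ⟨rfl, endsAt_nil (E.r e)⟩) he).1
      rw [List.length_append, List.length_singleton] at this
      omega
    have := pathElt_mul_star_mem_range (P := P) (S := S) hv (endsAt_nil v) (endsAt_nil v)
    rwa [pathElt_nil, h.star_proj, h.proj_mul_self] at this
  | succ n ih =>
    intro v l hl hn
    rcases (E.emits v).eq_empty_or_nonempty with hv | hv
    · have := pathElt_mul_star_mem_range (P := P) (S := S) hv (endsAt_nil v) (endsAt_nil v)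
      rwa [pathElt_nil, h.star_proj, h.proj_mul_self] at this
    · rw [h.proj_eq_sum v hv (Set.toFinite _)]
      refine Submodule.sum_mem _ fun e he => ?_
      have he : E.s e = v := by simpa [emits] using he
      have hr : P (E.r e) ∈ LinearMap.range (matrixMap (pathColumn P S)) := by
        refine ih (E.r e) _ (hl.append (endsAt_cons.2 ⟨rfl, endsAt_nil (E.r e)⟩) he).1 ?_
        rw [List.length_append, List.length_singleton]
        omega
      -- From `P (r e)` in the range come in turn `S e = S e * P (r e)`, its adjoint, and finally `S
      -- e * star (S e)`.
      have h1 := star_mem_range_matrixMap (h.isom_mul_mem_range e hr)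
      rw [h.isom_mul_proj] at h1
      exact h.isom_mul_mem_range e h1

omit [IsScalarTower ℂ R R] in
theorem IsCuntzKriegerFamily.isom_mem_range (h : IsCuntzKriegerFamily P S) (hE : E.NoCycles)
    (hf : E.IsFinite) (e : E.Edge) : S e ∈ LinearMap.range (matrixMap (pathColumn P S)) := by
  rw [← h.isom_mul_proj e]
  exact h.isom_mul_mem_range e (h.proj_mem_range hE hf _)

end decomposition

/-- The range of `Φ` is a subalgebra, so it suffices to reach the generators. -/
theorem mem_range_of_gen_mem_range {A R : Type*} [NonUnitalRing A] [Module ℂ A] [NonUnitalRing R]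
    [Module ℂ R] (Φ : A →ₙₐ[ℂ] R) (ψ : E.FreeAlg →ₙₐ[ℂ] R) (h : ∀ g, ∃ a, Φ a = ψ (E.gen g))
    (x : E.FreeAlg) : ∃ a, Φ a = ψ x := by
  induction x using MonoidAlgebra.induction_linear with
  | zero => exact ⟨0, by simp⟩
  | add x y hx hy =>
    obtain ⟨a, ha⟩ := hx
    obtain ⟨b, hb⟩ := hy
    exact ⟨a + b, by rw [map_add, map_add, ha, hb]⟩
  | single w c =>
    have hw : ∃ a, Φ a = ψ (.single w 1) := by
      induction w with
      | ih1 g => exact h g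
      | ih2 g w h1 h2 =>
        obtain ⟨a, ha⟩ := h1
        obtain ⟨b, hb⟩ := h2
        refine ⟨a * b, ?_⟩
        rw [map_mul, ha, hb, ← map_mul, MonoidAlgebra.single_mul_single, mul_one]
    obtain ⟨a, ha⟩ := hw
    refine ⟨c • a, ?_⟩
    rw [map_smul, ha, ← map_smul, MonoidAlgebra.smul_single]
    simp

/-! ### Both algebras as direct sums of matrix algebras -/

variable (E)

/-- The quotient map of the free algebra, as an algebra homomorphism. -/
def Leavitt.mkHom : E.FreeAlg →ₙₐ[ℂ] E.Leavitt :=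
  { Leavitt.mk E with
    map_zero' := (Leavitt.mk E).map_zero
    map_mul' := Leavitt.mk_mul E }

/-- This makes the purely algebraic matrix decomposition available in the Leavitt path algebra as
well as in the graph C*-algebra. -/
theorem Leavitt.isCuntzKriegerFamily :
    IsCuntzKriegerFamily (fun v => Leavitt.mk E (E.vt v)) (fun e => Leavitt.mk E (E.ed e)) where
  proj_mul_self v := Leavitt.mk_eq_of_rel E (.vert_mul_self v)
  star_proj v := by rw [← Leavitt.mk_star, star_vt]
  proj_orthogonal v w h := (Leavitt.mk_eq_of_rel E (.vert_mul_ne v w h)).trans (map_zero _)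
  isom e := by
    rw [← Leavitt.mk_star, star_ed, mul_assoc, ← Leavitt.mk_mul E (E.gh e),
      Leavitt.mk_eq_of_rel E (.ghost_mul_edge_self e)]
    exact Leavitt.mk_eq_of_rel E (.edge_mul_range e)
  star_isom e := by
    rw [← Leavitt.mk_star, star_ed, ← Leavitt.mk_mul E (E.gh e),
      Leavitt.mk_eq_of_rel E (.ghost_mul_edge_self e)]
    exact Leavitt.mk_eq_of_rel E (.range_mul_ghost e)
  range_orthogonal e f h := by
    rw [← Leavitt.mk_star, star_ed]
    exact (Leavitt.mk_eq_of_rel E (.ghost_mul_edge_ne e f h)).trans (map_zero _)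
  star_mul_self e := by
    rw [← Leavitt.mk_star, star_ed]
    exact Leavitt.mk_eq_of_rel E (.ghost_mul_edge_self e)
  proj_eq_sum v hne hfin := by
    refine (Leavitt.mk_eq_of_rel E (.vert_eq_sum v hne hfin)).trans ?_
    rw [map_sum]
    refine Finset.sum_congr rfl fun e _ => ?_
    rw [← Leavitt.mk_star, star_ed, Leavitt.mk_mul]
  range_le e := by
    rw [← mul_assoc, ← Leavitt.mk_mul, Leavitt.mk_eq_of_rel E (.source_mul_edge e)]

theorem Leavitt.vt_ne_zero (v : E.Vert) : Leavitt.mk E (E.vt v) ≠ 0 := fun h =>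
  CStar.proj_ne_zero E v (by rw [← iota_vert, h, map_zero])

theorem Leavitt.nonempty_starAlgEquiv (hf : E.IsFinite) (hE : E.NoCycles) :
    Nonempty (((v : {v : E.Vert // E.IsSink v}) →
      Matrix (Fin (E.numPathsTo v)) (Fin (E.numPathsTo v)) ℂ) ≃⋆ₐ[ℂ] E.Leavitt) := by
  have := hE.finite_pathTo hf
  have := hf.1
  have := Fintype.ofFinite {v : E.Vert // E.IsSink v}
  have H := Leavitt.isCuntzKriegerFamily E
  have hc := H.isColumnSystem (Leavitt.vt_ne_zero E)
  refine ⟨StarAlgEquiv.ofBijective (IsColumnSystem.matrixHom hc) ⟨hc.matrixMap_injective, fun x => ?_⟩⟩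
  obtain ⟨x, rfl⟩ := Leavitt.mk_surjective E x
  refine mem_range_of_gen_mem_range (IsColumnSystem.matrixHom hc).toNonUnitalAlgHom (Leavitt.mkHom E)
    (fun g => ?_) x
  cases g with
  | vert v => exact H.proj_mem_range hE hf v
  | edge e => exact H.isom_mem_range hE hf e
  | ghost e =>
    have := star_mem_range_matrixMap (H.isom_mem_range hE hf e)
    rwa [← Leavitt.mk_star, star_ed] at this

theorem CStar.nonempty_starAlgEquiv (hf : E.IsFinite) (hE : E.NoCycles) :
    Nonempty (((v : {v : E.Vert // E.IsSink v}) →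
      Matrix (Fin (E.numPathsTo v)) (Fin (E.numPathsTo v)) ℂ) ≃⋆ₐ[ℂ] E.CStar) := by
  have := hE.finite_pathTo hf
  have := hf.1
  have := Fintype.ofFinite {v : E.Vert // E.IsSink v}
  have H := CStar.isCuntzKriegerFamily E
  have hc := H.isColumnSystem (CStar.proj_ne_zero E)
  refine ⟨StarAlgEquiv.ofBijective (IsColumnSystem.matrixHom hc) ⟨hc.matrixMap_injective, fun x => ?_⟩⟩
  -- The range of the matrix algebra is finite dimensional, so only the dense image of the free
  -- algebra has to be reached.
  refine CStar.eq_top_of_ofFree_mem E (LinearMap.range (matrixMap _)) (fun x => ?_) x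
  refine mem_range_of_gen_mem_range (IsColumnSystem.matrixHom hc).toNonUnitalAlgHom
    (CStar.ofFree E).toNonUnitalAlgHom (fun g => ?_) x
  cases g with
  | vert v => exact H.proj_mem_range hE hf v
  | edge e => exact H.isom_mem_range hE hf e
  | ghost e =>
    have := star_mem_range_matrixMap (H.isom_mem_range hE hf e)
    rwa [CStar.star_isom] at this

theorem Leavitt.finiteDimensional (hf : E.IsFinite) (hE : E.NoCycles) :
    FiniteDimensional ℂ E.Leavitt := by
  have := hf.1
  have := Fintype.ofFinite {v : E.Vert // E.IsSink v}
  obtain ⟨φ⟩ := Leavitt.nonempty_starAlgEquiv E hf hE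
  let f : ((v : {v : E.Vert // E.IsSink v}) →
      Matrix (Fin (E.numPathsTo v)) (Fin (E.numPathsTo v)) ℂ) →ₗ[ℂ] E.Leavitt :=
    { toFun := φ
      map_add' := map_add φ
      map_smul' := map_smul φ }
  exact Module.Finite.of_surjective f (EquivLike.surjective φ)

end

end DirGraph

/-! ### The equivalences and the matrix decomposition -/

theorem mainTheorem8 (E : DirGraph.{u, v}) :
    List.TFAE [
      Function.Surjective E.iota,
      Nonempty (E.Leavitt ≃⋆ₐ[ℂ] E.CStar),
      Nonempty (E.Leavitt ≃⋆+* E.CStar),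
      E.IsFinite ∧ E.NoCycles,
      FiniteDimensional ℂ E.Leavitt,
      FiniteDimensional ℂ E.CStar] ∧
    (E.IsFinite ∧ E.NoCycles →
      (∀ v, Finite (E.PathTo v)) ∧
      Nonempty (E.Leavitt ≃⋆ₐ[ℂ] ((v : {v : E.Vert // E.IsSink v}) →
        Matrix (Fin (E.numPathsTo v)) (Fin (E.numPathsTo v)) ℂ)) ∧
      Nonempty (E.CStar ≃⋆ₐ[ℂ] ((v : {v : E.Vert // E.IsSink v}) →
        Matrix (Fin (E.numPathsTo v)) (Fin (E.numPathsTo v)) ℂ))) := by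
  constructor
  · tfae_have 1 → 6 := DirGraph.CStar.finiteDimensional_of_iota_surjective E
    tfae_have 2 → 3 := fun ⟨φ⟩ => ⟨{ φ with }⟩
    tfae_have 3 → 6 := fun ⟨φ⟩ => DirGraph.CStar.finiteDimensional_of_starRingEquiv E φ
    tfae_have 4 → 2 := fun ⟨hf, hE⟩ => by
      obtain ⟨φ⟩ := DirGraph.Leavitt.nonempty_starAlgEquiv E hf hE
      obtain ⟨ψ⟩ := DirGraph.CStar.nonempty_starAlgEquiv E hf hE
      exact ⟨φ.symm.trans ψ⟩
    tfae_have 4 → 5 := fun ⟨hf, hE⟩ => DirGraph.Leavitt.finiteDimensional E hf hE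
    tfae_have 5 → 1 := fun _ => DirGraph.iota_surjective_of_finiteDimensional E
    tfae_have 6 → 4 := fun _ =>
      ⟨DirGraph.isFinite_of_finiteDimensional E, DirGraph.noCycles_of_finiteDimensional E⟩
    tfae_finish
  · rintro ⟨hf, hE⟩
    obtain ⟨φ⟩ := DirGraph.Leavitt.nonempty_starAlgEquiv E hf hE
    obtain ⟨ψ⟩ := DirGraph.CStar.nonempty_starAlgEquiv E hf hE
    exact ⟨hE.finite_pathTo hf, ⟨φ.symm⟩, ⟨ψ.symm⟩⟩
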